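/- **Theorem (Convergence of EHGO estimates).** *Model.* Let $n\ge 1$ be the number of rotors and write $\|\cdot\|$ for Euclidean norms. Fix an inertia matrix $J=J^\top\succ0$, constants $m,b,\tau_m,\omega_{\max},\beta_1,\beta_2,\gamma_1,\gamma_2,c_\rho,a_1,a_2,a_3,a_\theta>0$, $g\in\mathbb R$, $0<\delta<\pi/2$, $0<c_\xi<(\beta_1+1)\delta^2/(2\beta_2)$, and $M\in\mathbb R^{4\times n}$. For Euler angles $\vartheta=(\phi,\theta,\psi)$ let $$\Psi=\begin{bmatrix}1&s_\phi t_\theta&c_\phi t_\theta\\0&c_\phi&-s_\phi\\0&s_\phi/c_\theta&c_\phi/c_\theta\end{bmatrix},\qquad R_3=\begin{bmatrix}c_\phi s_\theta c_\psi+s_\phi s_\psi\\c_\phi s_\theta s_\psi-s_\phi c_\psi\\c_\phi c_\theta\end{bmatrix},$$ where $c,s,t$ abbreviate cosine, sine and tangent. For $\xi=(\xi_1,\xi_2)\in\mathbb R^3\times\mathbb R^3$, $v=\xi_2+\dot\vartheta_r$ and $\Omega=\Psi^{-1}v$ let $$f(\xi,\vartheta_1,\dot\vartheta_r)=\dot\Psi\,\Omega-\Psi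 J^{-1}(\Omega\times J\Omega),$$ where $\Psi$ is taken at $\vartheta_1$ and $\dot\Psi$ is the derivative of $\Psi$ at $\vartheta_1$ in the direction $v$. Let $\bar f^1=g e_z-x_{c_3}$, $\bar f^2=f$, $\bar f^3=0$, and $$\bar G^1=b\,[-R_3/m\;\;0_3]M,\qquad \bar G^2=b\,[0_{3\times1}\;\;\Psi J^{-1}]M,\qquad \bar G^3=0.$$ *Observer matrices.* Let $(\varrho_1,\varrho_2,\varrho_3)=(3,3,4)$. Choose gains $\alpha^i_j$ such that each polynomial $s^{\varrho_i}+\alpha_1^is^{\varrho_i-1}+\dots+\alpha^i_{\varrho_i}$ is Hurwitz. Let $F_i$ be the block companion matrix with first block column $(-\alpha^i_1I_3,\dots,-\alpha^i_{\varrho_i}I_3)$, blocks $I_3$ on the block superdiagonal and zeros elsewhere. Let $B_1^i$ and $B_2^i$ have $I_3$ in the last but one and in the last block row, respectively, and zeros elsewhere. Let $P^i$ be the solution of $P^iF_i+F_i^\top P^i=-I$. *Domain of operation.* For $k_1,k_2>0$ let $$V_{k_1,k_2}(x_1,x_2)=\tfrac{k_1^2+k_1+k_2^2}{2k_1k_2}\|x_1\|^2+\tfrac1{k_1}x_1^\top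 x_2+\tfrac{k_1+1}{2k_1k_2}\|x_2\|^2 .$$ Put $\Omega_\xi=\{V_{\beta_1,\beta_2}<c_\xi\}$ and $\Omega_\rho=\{V_{\gamma_1,\gamma_2}<c_\rho\}$, and let $\Omega_\xi^{\rm sub}$ be a set whose closure is contained in $\Omega_\xi$. Consider continuous signals on $[0,\infty)$ which for all $t\ge0$ satisfy: $\rho\in\Omega_\rho$; $\xi\in\Omega^{\rm sub}_\xi$; $\vartheta_r$ with components of modulus $<\pi/2-\delta$; an estimate $\dot{\bar\vartheta}_r$ of $\dot\vartheta_r$ with $\|\dot{\bar\vartheta}_r\|\le a_\theta$; $x_c=(x_{c_1},x_{c_2})$ and $x_{c_3}$ with $\|x_{c_j}\|<a_j$; and $\omega_{sd}\in\mathbb R^n$ with $\omega_{sd,k}\ge0$ and $\sqrt{\omega_{sd,k}}\le\omega_{\max}$. Call such signals *admissible*. Put $\vartheta_1=\vartheta_r+\xi_1$, $W_{\rm des}=\mathrm{diag}(\sqrt{\omega_{sd,k}})$ and $q=(\rho,\xi)$. Let the disturbance dynamics $\varphi(t,q,x_c)=(\varphi^1,\varphi^2,\varphi^3)\in(\mathbb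 R^3)^3$ be continuous with $\|\varphi\|\le\kappa$ for $t\ge0$, $q\in\Omega_\rho\times\Omega_\xi$, $\|x_{c_1}\|<a_1$, $\|x_{c_2}\|<a_2$. *Error dynamics.* The state $\Delta=(\eta^1,\eta^2,\eta^3,\tilde\omega_s,\tilde\omega)\in\mathbb R^{9+9+12+2n}$, with $\eta^i=(\eta^i_1,\dots,\eta^i_{\varrho_i})$ and $\eta^i_j\in\mathbb R^3$, obeys $$\epsilon\dot\eta^i=F_i\eta^i+B_1^i\big[\Delta\bar f^i+\bar G^i(\vartheta_1)\tilde\omega_s\big]+\epsilon B_2^i\varphi^i(t,q,x_c),\quad i=1,2,3,$$ $$\tau_m\dot{\tilde\omega}_s=-2\tilde\omega_s+2W_{\rm des}\tilde\omega,\qquad \tau_m\dot{\tilde\omega}=-\tilde\omega,$$ where $\Delta\bar f^i=\bar f^i(\xi,x_{c_3},\vartheta_1,\dot{\bar\vartheta}_r)-\bar f^i(\hat\xi,\hat x_{c_3},\vartheta_1,\dot{\bar\vartheta}_r)$, $\hat\xi=(\xi_1-\epsilon^2\eta^2_1,\ \xi_2-\epsilon\eta^2_2)$ and $\hat x_{c_3}=x_{c_3}-\epsilon\eta^3_3$.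 *Lyapunov functions.* Let $\epsilon V_\eta=\sum_{i}(\eta^i)^\top P^i\eta^i$, $V_\omega=d_2\|\tilde\omega_s\|^2+\|\tilde\omega\|^2$, $V_\Delta=d_3V_\eta+V_\omega$, $\Omega_\omega=\{V_\omega\le c_\omega\}$ and $\Omega_\eta=\{\eta:\hat\xi\in\Omega_\xi\ \text{for all}\ \xi\in\Omega_\xi^{\rm sub}\}$. Let $c_\Delta$ be the supremum of all $c>0$ with $\{V_\Delta\le c\}\subseteq\Omega_\eta\times\Omega_\omega$, and $\Omega_\Delta=\{V_\Delta\le c_\Delta\}$. *Claim.* There are $C,\mu>0$ and $d_2^*>0$ such that for every $d_2\in(0,d_2^*)$ there is $d_3^*>0$ such that for all $c_\omega,\kappa>0$ there is $\epsilon^*>0$ such that for all $\epsilon\in(0,\epsilon^*)$ and all $d_3\in(0,d_3^*\epsilon^2)$ one has $c_\Delta>0$ and, for every $\varphi$ as above with bound $\kappa$ and all admissible signals: 1. from every $\Delta(0)\in\Omega_\Delta$ there is a solution of the error dynamics on $[0,\infty)$; 2. $\Omega_\Delta$ is positively invariant: every solution on an interval $[0,T]$ with $\Delta(0)\in\Omega_\Delta$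 stays in $\Omega_\Delta$; 3. every such solution converges exponentially to an $O(\epsilon\kappa)$ neighborhood of the origin: $$\|\Delta(t)\|\le C e^{-\mu t}\|\Delta(0)\|+C\,\epsilon\kappa .$$ -/

import Mathlib

open Matrix

noncomputable section

namespace EHGO

/-- Euclidean norm of a real column vector. -/
def vnorm {ι : Type*} [Fintype ι] (v : ι → ℝ) : ℝ := √(v ⬝ᵥ v)

/-- Number of three-dimensional blocks in the three observer channels
(translation, rotation, reference system). -/
def ord : Fin 3 → ℕ := ![3, 3, 4]

/-- Constants of the multi-rotor with `n` rotors, of the controller, of the observer,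
and of the domain of operation. -/
structure Params (n : ℕ) where
  /-- inertia matrix -/
  J : Matrix (Fin 3) (Fin 3) ℝ
  /-- mass -/
  m : ℝ
  /-- gravitational constant -/
  g : ℝ
  /-- thrust coefficient -/
  b : ℝ
  /-- geometry matrix, from rotor forces to thrust and torques -/
  M : Matrix (Fin 4) (Fin n) ℝ
  /-- actuator time constant -/
  τm : ℝ
  /-- maximal rotor rate -/
  ωmax : ℝ
  β₁ : ℝ
  β₂ : ℝ
  γ₁ : ℝ
  γ₂ : ℝ
  /-- observer gains; `α i j` is the gain of the `(j+1)`-st block of channel `i` -/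
  α : (i : Fin 3) → Fin (ord i) → ℝ
  δ : ℝ
  cξ : ℝ
  cρ : ℝ
  /-- bounds on position, velocity, acceleration of the reference system -/
  a₁ : ℝ
  a₂ : ℝ
  a₃ : ℝ
  /-- bound on the available estimate of the rate of the rotational reference -/
  aθ : ℝ
  hJ : J.PosDef
  hm : 0 < m
  hb : 0 < b
  hτm : 0 < τm
  hωmax : 0 < ωmax
  hβ₁ : 0 < β₁
  hβ₂ : 0 < β₂
  hγ₁ : 0 < γ₁
  hγ₂ : 0 < γ₂
  hδ : 0 < δ
  hδ' : δ < Real.pi / 2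
  hcξ : 0 < cξ
  hcξ' : cξ < (β₁ + 1) * δ ^ 2 / (2 * β₂)
  hcρ : 0 < cρ
  ha₁ : 0 < a₁
  ha₂ : 0 < a₂
  ha₃ : 0 < a₃
  haθ : 0 < aθ
  /-- `s ^ ϱ + α₁ s ^ (ϱ - 1) + ⋯ + α_ϱ` is Hurwitz for each channel -/
  hα : ∀ i, ∀ s : ℂ,
    s ^ ord i + ∑ j : Fin (ord i), (α i j : ℂ) * s ^ (ord i - 1 - (j : ℕ)) = 0 → s.re < 0

/-! ### Rotational kinematics and the model functions -/

/-- `Ψ`, from body angular velocity to Z-Y-X Euler angle rates; `ϑ = (φ, θ, ψ)`. -/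
def Psi (ϑ : Fin 3 → ℝ) : Matrix (Fin 3) (Fin 3) ℝ :=
  !![1, Real.sin (ϑ 0) * Real.tan (ϑ 1), Real.cos (ϑ 0) * Real.tan (ϑ 1);
     0, Real.cos (ϑ 0), -Real.sin (ϑ 0);
     0, Real.sin (ϑ 0) / Real.cos (ϑ 1), Real.cos (ϑ 0) / Real.cos (ϑ 1)]

/-- The time derivative of `Ψ` at Euler angles `ϑ` with Euler angle rates `v`. -/
def PsiDot (ϑ v : Fin 3 → ℝ) : Matrix (Fin 3) (Fin 3) ℝ :=
  v 0 •
    !![0, Real.cos (ϑ 0) * Real.tan (ϑ 1), -(Real.sin (ϑ 0) * Real.tan (ϑ 1));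
       0, -Real.sin (ϑ 0), -Real.cos (ϑ 0);
       0, Real.cos (ϑ 0) / Real.cos (ϑ 1), -(Real.sin (ϑ 0) / Real.cos (ϑ 1))] +
  v 1 •
    !![0, Real.sin (ϑ 0) / Real.cos (ϑ 1) ^ 2, Real.cos (ϑ 0) / Real.cos (ϑ 1) ^ 2;
       0, 0, 0;
       0, Real.sin (ϑ 0) * Real.sin (ϑ 1) / Real.cos (ϑ 1) ^ 2,
          Real.cos (ϑ 0) * Real.sin (ϑ 1) / Real.cos (ϑ 1) ^ 2]

/-- Third column of the rotation matrix. -/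
def R3 (ϑ : Fin 3 → ℝ) : Fin 3 → ℝ :=
  ![Real.cos (ϑ 0) * Real.sin (ϑ 1) * Real.cos (ϑ 2) + Real.sin (ϑ 0) * Real.sin (ϑ 2),
    Real.cos (ϑ 0) * Real.sin (ϑ 1) * Real.sin (ϑ 2) - Real.sin (ϑ 0) * Real.cos (ϑ 2),
    Real.cos (ϑ 0) * Real.cos (ϑ 1)]

/-- A pair of vectors in `ℝ³`: a tracking error together with its rate. -/
abbrev Pair := (Fin 3 → ℝ) × (Fin 3 → ℝ)

variable {n : ℕ}

/-- The rotational drift `f (ξ, ϑ₁, ϑ̇_r)`. -/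
def f (p : Params n) (ξ : Pair) (ϑ₁ ϑr' : Fin 3 → ℝ) : Fin 3 → ℝ :=
  let v := ξ.2 + ϑr'
  let Ω := (Psi ϑ₁)⁻¹ *ᵥ v
  PsiDot ϑ₁ v *ᵥ Ω - (Psi ϑ₁ * p.J⁻¹) *ᵥ (crossProduct Ω (p.J *ᵥ Ω))

/-- The three blocks of the nominal drift `f̄ (ξ, x_{c₃}, ϑ₁, ϑ̇_r)`. -/
def fbar (p : Params n) (ξ : Pair) (xc₃ ϑ₁ ϑr' : Fin 3 → ℝ) : Fin 3 → (Fin 3 → ℝ) :=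
  ![![0, 0, p.g] - xc₃, f p ξ ϑ₁ ϑr', 0]

/-- The three row blocks of the input matrix `Ḡ (ϑ₁)`. -/
def Gbar (p : Params n) (ϑ₁ : Fin 3 → ℝ) : Fin 3 → Matrix (Fin 3) (Fin n) ℝ :=
  ![p.b • (Matrix.of (fun k => Fin.cons (-(R3 ϑ₁ k) / p.m) (fun _ : Fin 3 => (0 : ℝ))) * p.M),
    p.b • (Matrix.of (fun k => Fin.cons 0 ((Psi ϑ₁ * p.J⁻¹) k)) * p.M),
    0]

/-! ### Observer matrices -/

/-- `F_i`: block companion matrix with blocks that are multiples of the `3 × 3` identity. -/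
def F (p : Params n) (i : Fin 3) :
    Matrix (Fin (ord i) × Fin 3) (Fin (ord i) × Fin 3) ℝ :=
  Matrix.of fun r c =>
    if r.2 = c.2 then
      if (c.1 : ℕ) = 0 then -p.α i r.1
      else if (c.1 : ℕ) = (r.1 : ℕ) + 1 then 1 else 0
    else 0

/-- Identity in the last but one block row. -/
def B₁ (i : Fin 3) : Matrix (Fin (ord i) × Fin 3) (Fin 3) ℝ :=
  Matrix.of fun r k => if (r.1 : ℕ) + 2 = ord i ∧ r.2 = k then 1 else 0

/-- Identity in the last block row. -/
def B₂ (i : Fin 3) : Matrix (Fin (ord i) × Fin 3) (Fin 3) ℝ :=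
  Matrix.of fun r k => if (r.1 : ℕ) + 1 = ord i ∧ r.2 = k then 1 else 0

/-! ### The error state -/

/-- Scaled observer errors `(η¹, η², η³)`; `η i (j, k)` is component `k` of block `j + 1`. -/
abbrev Eta := (i : Fin 3) → Fin (ord i) × Fin 3 → ℝ

/-- The state `Δ = (η, ω̃_s, ω̃)`. -/
abbrev State (n : ℕ) := Eta × (Fin n → ℝ) × (Fin n → ℝ)

/-- Euclidean norm of `Δ`. -/
def stateNorm (Δ : State n) : ℝ :=
  √(∑ i, Δ.1 i ⬝ᵥ Δ.1 i + Δ.2.1 ⬝ᵥ Δ.2.1 + Δ.2.2 ⬝ᵥ Δ.2.2)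

/-- `ξ̂ = (ξ₁ - ε² η²₁, ξ₂ - ε η²₂)`. -/
def xiHat (ε : ℝ) (ξ : Pair) (η : Eta) : Pair :=
  (fun k => ξ.1 k - ε ^ 2 * η 1 (⟨0, by decide⟩, k),
   fun k => ξ.2 k - ε * η 1 (⟨1, by decide⟩, k))

/-- `x̂_{c₃} = x_{c₃} - ε η³₃`. -/
def xc3Hat (ε : ℝ) (xc₃ : Fin 3 → ℝ) (η : Eta) : Fin 3 → ℝ :=
  fun k => xc₃ k - ε * η 2 (⟨2, by decide⟩, k)

/-! ### Domain of operation -/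

/-- The quadratic form `xᵀ P x` of the solution `P` of the Lyapunov equation
`P A + Aᵀ P = -I` for `A = [0 I; -k₁ I  -k₂ I]`. -/
def Vquad (k₁ k₂ : ℝ) (x : Pair) : ℝ :=
  (k₁ ^ 2 + k₁ + k₂ ^ 2) / (2 * k₁ * k₂) * (x.1 ⬝ᵥ x.1) +
    2 * (1 / (2 * k₁)) * (x.1 ⬝ᵥ x.2) +
    (k₁ + 1) / (2 * k₁ * k₂) * (x.2 ⬝ᵥ x.2)

/-- `Ω_ξ`. -/
def Ωξ (p : Params n) : Set Pair := {ξ | Vquad p.β₁ p.β₂ ξ < p.cξ}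

/-- `Ω_ρ`. -/
def Ωρ (p : Params n) : Set Pair := {ρ | Vquad p.γ₁ p.γ₂ ρ < p.cρ}

/-- The signals that drive the error dynamics: translational error `ρ`, rotational error `ξ`,
rotational reference `ϑr`, available estimate `ϑr'` of the rate of the rotational reference,
reference system state `xc = (x_{c₁}, x_{c₂})` and acceleration `xc₃`, and commanded squared
rotor rates `ωsd`. -/
structure Signals (n : ℕ) where
  ρ : ℝ → Pair
  ξ : ℝ → Pair
  ϑr : ℝ → Fin 3 → ℝ
  ϑr' : ℝ → Fin 3 → ℝ
  xc : ℝ → Pair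
  xc₃ : ℝ → Fin 3 → ℝ
  ωsd : ℝ → Fin n → ℝ

/-- The signals are continuous and stay in the domain of operation for all `t ≥ 0`, the
rotational error being in the subset `Ωsub` of `Ω_ξ`. -/
structure Signals.Admissible (s : Signals n) (p : Params n) (Ωsub : Set Pair) : Prop where
  cont_ρ : ContinuousOn s.ρ (Set.Ici 0)
  cont_ξ : ContinuousOn s.ξ (Set.Ici 0)
  cont_ϑr : ContinuousOn s.ϑr (Set.Ici 0)
  cont_ϑr' : ContinuousOn s.ϑr' (Set.Ici 0)
  cont_xc : ContinuousOn s.xc (Set.Ici 0)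
  cont_xc₃ : ContinuousOn s.xc₃ (Set.Ici 0)
  cont_ωsd : ContinuousOn s.ωsd (Set.Ici 0)
  mem_ρ : ∀ t, 0 ≤ t → s.ρ t ∈ Ωρ p
  mem_ξ : ∀ t, 0 ≤ t → s.ξ t ∈ Ωsub
  bound_ϑr : ∀ t, 0 ≤ t → ∀ k, |s.ϑr t k| < Real.pi / 2 - p.δ
  bound_ϑr' : ∀ t, 0 ≤ t → vnorm (s.ϑr' t) ≤ p.aθ
  bound_xc₁ : ∀ t, 0 ≤ t → vnorm (s.xc t).1 < p.a₁
  bound_xc₂ : ∀ t, 0 ≤ t → vnorm (s.xc t).2 < p.a₂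
  bound_xc₃ : ∀ t, 0 ≤ t → vnorm (s.xc₃ t) < p.a₃
  nonneg_ωsd : ∀ t, 0 ≤ t → ∀ k, 0 ≤ s.ωsd t k
  bound_ωsd : ∀ t, 0 ≤ t → ∀ k, √(s.ωsd t k) ≤ p.ωmax

/-- Disturbance dynamics: the three blocks of `φ (t, q, x_c)`, with `q = (ρ, ξ)`. -/
abbrev Disturbance := ℝ → Pair × Pair → Pair → Fin 3 → (Fin 3 → ℝ)

/-- `φ` is continuous and `‖φ (t, q, x_c)‖ ≤ κ` on the domain of operation. -/
def BoundedBy (p : Params n) (φ : Disturbance) (κ : ℝ) : Prop :=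
  Continuous (fun z : ℝ × (Pair × Pair) × Pair => φ z.1 z.2.1 z.2.2) ∧
  ∀ t, 0 ≤ t → ∀ ρ ∈ Ωρ p, ∀ ξ ∈ Ωξ p, ∀ xc : Pair,
    vnorm xc.1 < p.a₁ → vnorm xc.2 < p.a₂ →
      √(∑ i, φ t (ρ, ξ) xc i ⬝ᵥ φ t (ρ, ξ) xc i) ≤ κ

/-! ### The error dynamics -/

/-- Right-hand side of the cascade of scaled observer error dynamics and actuator error
dynamics, solved for the derivatives; `ϑ₁ = ϑ_r + ξ₁`. -/
def rhs (p : Params n) (φ : Disturbance) (s : Signals n) (ε t : ℝ) (Δ : State n) : State n :=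
  let ϑ₁ := s.ϑr t + (s.ξ t).1
  (fun i => ε⁻¹ • (F p i *ᵥ Δ.1 i
      + B₁ i *ᵥ (fbar p (s.ξ t) (s.xc₃ t) ϑ₁ (s.ϑr' t) i
          - fbar p (xiHat ε (s.ξ t) Δ.1) (xc3Hat ε (s.xc₃ t) Δ.1) ϑ₁ (s.ϑr' t) i
          + Gbar p ϑ₁ i *ᵥ Δ.2.1)
      + ε • (B₂ i *ᵥ φ t (s.ρ t, s.ξ t) (s.xc t) i)),
   p.τm⁻¹ • (-(2 : ℝ) • Δ.2.1
      + (2 : ℝ) • (Matrix.diagonal (fun k => √(s.ωsd t k)) *ᵥ Δ.2.2)),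
   p.τm⁻¹ • (-Δ.2.2))

/-- `Δ` solves the error dynamics on the time interval `I`. -/
def IsSolution (p : Params n) (φ : Disturbance) (s : Signals n) (ε : ℝ) (I : Set ℝ)
    (Δ : ℝ → State n) : Prop :=
  ∀ t ∈ I, HasDerivWithinAt Δ (rhs p φ s ε t (Δ t)) I t

/-! ### Lyapunov functions and their sublevel sets -/

/-- Family of matrices that define the observer Lyapunov function. -/
abbrev ObsMatrices := (i : Fin 3) → Matrix (Fin (ord i) × Fin 3) (Fin (ord i) × Fin 3) ℝ

/-- `V_η`, given by `ε V_η = ∑ᵢ (ηⁱ)ᵀ Pⁱ ηⁱ`. -/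
def Vη (P : ObsMatrices) (ε : ℝ) (η : Eta) : ℝ := ε⁻¹ * ∑ i, η i ⬝ᵥ (P i *ᵥ η i)

/-- `V_ω = d₂ ‖ω̃_s‖² + ‖ω̃‖²`. -/
def Vω (d₂ : ℝ) (w : (Fin n → ℝ) × (Fin n → ℝ)) : ℝ := d₂ * (w.1 ⬝ᵥ w.1) + w.2 ⬝ᵥ w.2

/-- `V_Δ = d₃ V_η + V_ω`. -/
def VΔ (P : ObsMatrices) (d₂ d₃ ε : ℝ) (Δ : State n) : ℝ := d₃ * Vη P ε Δ.1 + Vω d₂ Δ.2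

/-- `Ω_ω`. -/
def Ωω (n : ℕ) (d₂ cω : ℝ) : Set ((Fin n → ℝ) × (Fin n → ℝ)) := {w | Vω d₂ w ≤ cω}

/-- `Ω_η`: observer errors for which `ξ̂ ∈ Ω_ξ` whenever `ξ ∈ Ωsub`. -/
def Ωη (p : Params n) (Ωsub : Set Pair) (ε : ℝ) : Set Eta :=
  {η | ∀ ξ ∈ Ωsub, xiHat ε ξ η ∈ Ωξ p}

/-- `c_Δ`: the largest (in general, the supremum of the) `c > 0` with
`{V_Δ ≤ c} ⊆ Ω_η × Ω_ω`. -/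
def cΔ (p : Params n) (Ωsub : Set Pair) (P : ObsMatrices) (d₂ d₃ cω ε : ℝ) : ℝ :=
  sSup {c : ℝ | 0 < c ∧ {Δ : State n | VΔ P d₂ d₃ ε Δ ≤ c} ⊆ Ωη p Ωsub ε ×ˢ Ωω n d₂ cω}

/-- `Ω_Δ = {V_Δ ≤ c_Δ}`. -/
def ΩΔ (p : Params n) (Ωsub : Set Pair) (P : ObsMatrices) (d₂ d₃ cω ε : ℝ) : Set (State n) :=
  {Δ | VΔ P d₂ d₃ ε Δ ≤ cΔ p Ωsub P d₂ d₃ cω ε}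

end EHGO

end

noncomputable section

open Filter Topology

namespace EHGO

/-! ### Euclidean and Frobenius norms on function types, whose built-in norm is the sup norm. -/

section Norms

variable {ι κ : Type*} [Fintype ι] [Fintype κ]

/-! The error dynamics are a cascade: the actuator errors evolve independently of `η` and decay at a
rate fixed by `τm`, while the observer errors live on the fast time scale `ε`. On that scale the
Lyapunov equation dissipates `‖η‖²`. The estimates differ from the true values by `ε` times
components of `η`, so the drift mismatch is `O(ε‖η‖)` and is absorbed for small `ε`; what remains is
forcing by `ω̃_s` and by `εκ` (`exists_observer_dissipation`). The Lipschitz constant behind this is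
uniform because the bound on `cξ` keeps the pitch angle away from `±π/2`, and because the rate
estimates are bounded on `Ω_Δ` (`vnorm_xiHat_le_of_mem_ΩΔ`).

Invariance: if `d₃/ε²` is small, the actuator dissipation dominates the forcing by `ω̃_s`, and `V_Δ`
decreases wherever it exceeds `τm C₂ d₃ κ²` (`VΔ_deriv_neg`). For small `ε` the level `c_Δ` lies
above this threshold (`le_cΔ`).

Convergence: `V_Δ` is not used here, since comparing it with the Euclidean norm would bring `d₂`,
`d₃` and `ε` into the constants. Instead the cascade is integrated: the actuator errors decay by
themselves, and the observer form, a fast variable driven by them, stays below an explicit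
supersolution (`le_of_fast_deriv_le`, `exists_exponential_bound`).

Existence: the dynamics are Lipschitz only on bounded sets, so the state is truncated; the truncated
system has global solutions, and invariance shows that the truncation is never active
(`exists_solution`).

Coercivity of `P` follows from its Lyapunov equation alone, without symmetry, through the Cayley
transform of the Hurwitz matrix (`coercive_of_lyapunov`). -/

theorem vnorm_eq_norm (v : ι → ℝ) : vnorm v = ‖WithLp.toLp 2 v‖ := by
  rw [EuclideanSpace.norm_eq, vnorm]
  simp [dotProduct, sq]

theorem vnorm_nonneg (v : ι → ℝ) : 0 ≤ vnorm v := Real.sqrt_nonneg _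

theorem dotProduct_self_nonneg' (v : ι → ℝ) : 0 ≤ v ⬝ᵥ v :=
  Finset.sum_nonneg fun i _ => mul_self_nonneg (v i)

theorem vnorm_sq (v : ι → ℝ) : vnorm v ^ 2 = v ⬝ᵥ v :=
  Real.sq_sqrt (dotProduct_self_nonneg' v)

theorem abs_dotProduct_le (u v : ι → ℝ) : |u ⬝ᵥ v| ≤ vnorm u * vnorm v := by
  rw [vnorm_eq_norm, vnorm_eq_norm, mul_comm]
  have := abs_real_inner_le_norm (WithLp.toLp 2 v) (WithLp.toLp 2 u)
  simpa [EuclideanSpace.inner_eq_star_dotProduct] using this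

theorem vnorm_add_le (u v : ι → ℝ) : vnorm (u + v) ≤ vnorm u + vnorm v := by
  simp only [vnorm_eq_norm, WithLp.toLp_add]
  exact norm_add_le _ _

theorem vnorm_sub_le (u v : ι → ℝ) : vnorm (u - v) ≤ vnorm u + vnorm v := by
  simp only [vnorm_eq_norm, WithLp.toLp_sub]
  exact norm_sub_le _ _

theorem vnorm_smul (c : ℝ) (v : ι → ℝ) : vnorm (c • v) = |c| * vnorm v := by
  simp only [vnorm_eq_norm, WithLp.toLp_smul]
  rw [norm_smul, Real.norm_eq_abs]

theorem vnorm_zero : vnorm (0 : ι → ℝ) = 0 := by simp [vnorm]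

theorem vnorm_neg (v : ι → ℝ) : vnorm (-v) = vnorm v := by simp [vnorm]

theorem abs_apply_le_vnorm (v : ι → ℝ) (i : ι) : |v i| ≤ vnorm v := by
  rw [vnorm]
  refine Real.abs_le_sqrt ?_
  rw [sq]
  exact Finset.single_le_sum (f := fun i => v i * v i) (fun i _ => mul_self_nonneg (v i))
    (Finset.mem_univ i)

theorem norm_le_vnorm (v : ι → ℝ) : ‖v‖ ≤ vnorm v :=
  (pi_norm_le_iff_of_nonneg (vnorm_nonneg v)).2 fun i => abs_apply_le_vnorm v i

theorem vnorm_le_card_mul_norm (v : ι → ℝ) : vnorm v ≤ √(Fintype.card ι) * ‖v‖ := by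
  rw [← Real.sqrt_sq (norm_nonneg v), ← Real.sqrt_mul (by positivity), vnorm]
  refine Real.sqrt_le_sqrt ?_
  have : ∀ i ∈ Finset.univ, v i * v i ≤ ‖v‖ ^ 2 := fun i _ => by
    have := norm_le_pi_norm v i
    rw [← sq, ← sq_abs, ← Real.norm_eq_abs]
    gcongr
  simpa [dotProduct] using Finset.sum_le_sum this

/-- Euclidean norm of a subvector. -/
theorem vnorm_comp_le (v : ι → ℝ) (e : κ → ι) (he : Function.Injective e) :
    vnorm (fun k => v (e k)) ≤ vnorm v := by
  classical
  refine Real.sqrt_le_sqrt ?_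
  simp only [dotProduct]
  rw [← Finset.sum_image (f := fun i => v i * v i) (s := Finset.univ) (g := e) he.injOn]
  exact Finset.sum_le_sum_of_subset_of_nonneg (Finset.subset_univ _)
    fun i _ _ => mul_self_nonneg (v i)

/-- Frobenius norm. -/
def frob (A : Matrix ι κ ℝ) : ℝ := √(∑ i, A.row i ⬝ᵥ A.row i)

theorem frob_nonneg (A : Matrix ι κ ℝ) : 0 ≤ frob A := Real.sqrt_nonneg _

theorem vnorm_mulVec_le (A : Matrix ι κ ℝ) (v : κ → ℝ) : vnorm (A *ᵥ v) ≤ frob A * vnorm v := by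
  have h : A *ᵥ v ⬝ᵥ A *ᵥ v ≤ (∑ i, A.row i ⬝ᵥ A.row i) * (v ⬝ᵥ v) := by
    rw [Finset.sum_mul]
    refine Finset.sum_le_sum fun i _ => ?_
    have h : |(A *ᵥ v) i| ≤ vnorm (A.row i) * vnorm v := abs_dotProduct_le (A.row i) v
    rw [← vnorm_sq, ← vnorm_sq, ← mul_pow, ← sq, ← sq_abs]
    gcongr
  have h0 : 0 ≤ ∑ i, A.row i ⬝ᵥ A.row i :=
    Finset.sum_nonneg fun i _ => dotProduct_self_nonneg' _
  rw [frob, vnorm, vnorm, ← Real.sqrt_mul h0]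
  exact Real.sqrt_le_sqrt h

theorem abs_dotProduct_mulVec_le (A : Matrix ι κ ℝ) (u : ι → ℝ) (v : κ → ℝ) :
    |u ⬝ᵥ A *ᵥ v| ≤ frob A * (vnorm u * vnorm v) := by
  refine (abs_dotProduct_le _ _).trans ?_
  have := mul_le_mul_of_nonneg_left (vnorm_mulVec_le A v) (vnorm_nonneg u)
  linarith

theorem continuousOn_frob {X : Type*} [TopologicalSpace X] {s : Set X} {A : X → Matrix ι κ ℝ}
    (hA : ContinuousOn A s) : ContinuousOn (fun x => frob (A x)) s := by
  have : Continuous fun A : Matrix ι κ ℝ => frob A := by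
    unfold frob dotProduct Matrix.row
    fun_prop
  exact this.comp_continuousOn hA

end Norms

/-! ### The Lyapunov equation of a Hurwitz matrix -/

section Lyapunov

variable {ι : Type*} [Fintype ι] [DecidableEq ι]

-- The spectrum is compact, so the spectral radius is below 1. By Gelfand's formula, any `q`
-- strictly between the two gives `‖A ^ k‖ ≤ q ^ k` for all large `k`.
attribute [local instance] Matrix.linftyOpNormedRing Matrix.linftyOpNormedAlgebra in
theorem tendsto_pow_zero_of_spectrum (A : Matrix ι ι ℂ) (h : ∀ z ∈ spectrum ℂ A, ‖z‖ < 1) :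
    Tendsto (fun k : ℕ => A ^ k) atTop (𝓝 0) := by
  rcases isEmpty_or_nonempty ι with hι | hι
  · have : (fun k : ℕ => A ^ k) = fun _ => 0 := by
      funext k; exact Subsingleton.elim _ _
    rw [this]; exact tendsto_const_nhds
  have h1 : spectralRadius ℂ A < ((1 : NNReal) : ENNReal) :=
    spectrum.spectralRadius_lt_of_forall_lt A fun z hz => by
      rw [← NNReal.coe_lt_coe]; simpa using h z hz
  obtain ⟨q, hq1, hq2⟩ := ENNReal.lt_iff_exists_nnreal_btwn.1 h1
  have h2 := spectrum.pow_nnnorm_pow_one_div_tendsto_nhds_spectralRadius A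
  have h3 := h2.eventually_lt_const hq1
  have h4 : ∀ᶠ k : ℕ in atTop, ‖A ^ k‖ ≤ (q : ℝ) ^ k := by
    filter_upwards [h3, eventually_gt_atTop 0] with k hk hk0
    have hk0' : (0 : ℝ) < k := by exact_mod_cast hk0
    have := ENNReal.rpow_le_rpow hk.le hk0'.le
    rw [← ENNReal.rpow_mul, one_div, inv_mul_cancel₀ hk0'.ne', ENNReal.rpow_one,
      ENNReal.rpow_natCast] at this
    exact_mod_cast this
  refine (tendsto_zero_iff_norm_tendsto_zero (f := fun k : ℕ => A ^ k)).2 ?_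
  refine tendsto_of_tendsto_of_tendsto_of_le_of_le' tendsto_const_nhds
    (tendsto_pow_atTop_nhds_zero_of_lt_one q.2 (by exact_mod_cast hq2))
    (Eventually.of_forall fun k => norm_nonneg _) h4

theorem exists_eigenvector_of_mem_spectrum (A : Matrix ι ι ℂ) {z : ℂ} (hz : z ∈ spectrum ℂ A) :
    ∃ v ≠ 0, A *ᵥ v = z • v := by
  rw [spectrum.mem_iff, Matrix.isUnit_iff_isUnit_det, isUnit_iff_ne_zero, not_not] at hz
  obtain ⟨v, hv, h⟩ := Matrix.exists_mulVec_eq_zero_iff.2 hz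
  refine ⟨v, hv, ?_⟩
  rw [Matrix.sub_mulVec, Matrix.algebraMap_eq_diagonal, sub_eq_zero] at h
  rw [← h]
  ext i
  simp [Matrix.mulVec_diagonal]

/-- If all eigenvalues of `F` lie in the open left half plane, then `P F + Fᵀ P = -1` forces the
quadratic form of `P` to be coercive. -/
theorem coercive_of_lyapunov (F P : Matrix ι ι ℝ)
    (hF : ∀ (z : ℂ) (u : ι → ℂ), u ≠ 0 → F.map Complex.ofRealHom *ᵥ u = z • u → z.re < 0)
    (hP : P * F + Fᵀ * P = -1) :
    ∃ c > 0, ∀ x, c * (x ⬝ᵥ x) ≤ x ⬝ᵥ P *ᵥ x := by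
  -- The number 1 has positive real part, hence is not an eigenvalue of `F`.
  have hdet : IsUnit (1 - F).det := by
    rw [isUnit_iff_ne_zero]
    intro h0
    obtain ⟨v, hv, h⟩ := Matrix.exists_mulVec_eq_zero_iff.2 h0
    rw [Matrix.sub_mulVec, Matrix.one_mulVec, sub_eq_zero] at h
    have := hF 1 (Complex.ofRealHom ∘ v) ?_ ?_
    · norm_num at this
    · intro h'
      apply hv
      ext i
      have := congrFun h' i
      simpa using this
    · ext i
      rw [← RingHom.map_mulVec, ← h]
      simp
  -- Cayley transform: `A = (1 + F)(1 - F)⁻¹` maps the open left half plane of eigenvalues into the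
  -- unit disc, which replaces the integral of the matrix exponential by powers of `A`.
  set N := (1 - F)⁻¹ with hN
  have hN1 : (1 - F) * N = 1 := Matrix.mul_nonsing_inv _ hdet
  set A := (1 + F) * N with hA
  have hpow : Tendsto (fun k : ℕ => A ^ k) atTop (𝓝 0) := by
    have hc : Tendsto (fun k : ℕ => (A.map Complex.ofRealHom) ^ k) atTop (𝓝 0) := by
      refine tendsto_pow_zero_of_spectrum _ fun z hz => ?_
      obtain ⟨v, hv, h⟩ := exists_eigenvector_of_mem_spectrum _ hz
      set u := N.map Complex.ofRealHom *ᵥ v with hu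
      have e1 : u - F.map Complex.ofRealHom *ᵥ u = v := by
        have := congrArg (fun B : Matrix ι ι ℝ => B.map Complex.ofRealHom *ᵥ v) hN1
        simp only [Matrix.map_mul, ← Matrix.mulVec_mulVec] at this
        rw [Matrix.map_sub _ (by simp), ← hu, Matrix.sub_mulVec] at this
        simpa using this
      have e2 : u + F.map Complex.ofRealHom *ᵥ u = z • v := by
        rw [← h, hA]
        simp only [Matrix.map_mul, ← Matrix.mulVec_mulVec]
        rw [Matrix.map_add _ (by simp), ← hu, Matrix.add_mulVec]
        simp
      have e3 : (1 + z) • (F.map Complex.ofRealHom *ᵥ u) = (z - 1) • u := by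
        rw [← e1, smul_sub] at e2
        rw [add_smul, sub_smul, one_smul, one_smul]
        linear_combination e2
      have hu0 : u ≠ 0 := by
        rintro h0
        rw [h0] at e1
        apply hv
        rw [← e1]; simp
      have hz1 : 1 + z ≠ 0 := by
        intro h0
        have hz' : z = -1 := by linear_combination h0
        rw [h0, zero_smul, hz'] at e3
        have := (smul_eq_zero.1 e3.symm).resolve_right hu0
        norm_num at this
      have h5 := hF ((z - 1) / (1 + z)) u hu0 (by
        rw [div_eq_inv_mul, mul_smul, ← e3, smul_smul, inv_mul_cancel₀ hz1, one_smul])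
      -- The real part of `(z - 1) / (1 + z)` is `(|z|² - 1) / |1 + z|²`, so its sign decides
      -- whether `|z| < 1`.
      have hns : 0 < Complex.normSq (1 + z) := Complex.normSq_pos.2 hz1
      rw [Complex.div_re, ← add_div, div_lt_iff₀ hns] at h5
      simp at h5
      rw [← sq_lt_one_iff₀ (norm_nonneg z), ← Complex.normSq_eq_norm_sq, Complex.normSq_apply]
      nlinarith
    have hre : Tendsto (fun k : ℕ => ((A.map Complex.ofRealHom) ^ k).map Complex.re) atTop
        (𝓝 ((0 : Matrix ι ι ℂ).map Complex.re)) := by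
      have : Continuous fun B : Matrix ι ι ℂ => B.map Complex.re :=
        continuous_id.matrix_map Complex.continuous_re
      exact (this.tendsto 0).comp hc
    have e : (fun k : ℕ => ((A.map Complex.ofRealHom) ^ k).map Complex.re) = fun k => A ^ k := by
      funext k
      have : (A.map Complex.ofRealHom) ^ k = (A ^ k).map Complex.ofRealHom :=
        (map_pow (Complex.ofRealHom.mapMatrix) A k).symm
      rw [this]
      ext i j
      simp
    rw [e] at hre
    convert hre using 2
    ext i j
    simp
  set q : (ι → ℝ) → ℝ := fun x => x ⬝ᵥ P *ᵥ x with hq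
  -- With `x = u - F u` and `A x = u + F u`, only the cross terms survive in `q (A x) - q x`, and
  -- they are twice the Lyapunov equation tested on `u`.
  have hstep : ∀ x, q (A *ᵥ x) = q x - 2 * (N *ᵥ x ⬝ᵥ N *ᵥ x) := by
    intro x
    set u := N *ᵥ x with hu
    have e1 : x = u - F *ᵥ u := by
      have := congrArg (fun B : Matrix ι ι ℝ => B *ᵥ x) hN1
      simp only [← Matrix.mulVec_mulVec] at this
      rw [← hu] at this
      simpa [Matrix.sub_mulVec] using this.symm
    have e2 : A *ᵥ x = u + F *ᵥ u := by
      rw [hA, ← Matrix.mulVec_mulVec, ← hu, Matrix.add_mulVec, Matrix.one_mulVec]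
    have e3 : u ⬝ᵥ P *ᵥ F *ᵥ u + F *ᵥ u ⬝ᵥ P *ᵥ u = -(u ⬝ᵥ u) := by
      have := congrArg (fun B : Matrix ι ι ℝ => u ⬝ᵥ B *ᵥ u) hP
      simp only [Matrix.add_mulVec, dotProduct_add, ← Matrix.mulVec_mulVec, Matrix.neg_mulVec,
        Matrix.one_mulVec, dotProduct_neg] at this
      rw [← this, Matrix.dotProduct_mulVec u Fᵀ, Matrix.vecMul_transpose]
    have e4 : q x = (u - F *ᵥ u) ⬝ᵥ P *ᵥ (u - F *ᵥ u) := by rw [← e1]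
    rw [e4, e2, hq]
    simp only [Matrix.mulVec_add, Matrix.mulVec_sub, dotProduct_add, dotProduct_sub,
      add_dotProduct, sub_dotProduct]
    linarith
  -- The values `q (A ^ k x)` never exceed `q x` and tend to 0.
  have hnonneg : ∀ x, 0 ≤ q x := by
    intro x
    have hle : ∀ k : ℕ, q (A ^ k *ᵥ x) ≤ q x := by
      intro k
      induction k with
      | zero => simp
      | succ k ih =>
        rw [pow_succ', ← Matrix.mulVec_mulVec, hstep]
        have := dotProduct_self_nonneg' (N *ᵥ A ^ k *ᵥ x)
        linarith
    have hcont : Continuous fun B : Matrix ι ι ℝ => q (B *ᵥ x) := by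
      simp only [hq]
      fun_prop
    have hlim := (hcont.tendsto 0).comp hpow
    have h0 : q ((0 : Matrix ι ι ℝ) *ᵥ x) = 0 := by simp [hq]
    rw [h0] at hlim
    exact le_of_tendsto hlim (Eventually.of_forall hle)
  -- Now `q x ≥ 2 ‖N x‖²`, and `x = (1 - F) N x` bounds `‖x‖` by `‖N x‖`. The added 1 only keeps the
  -- denominator positive.
  refine ⟨2 / (frob (1 - F) ^ 2 + 1), by positivity, fun x => ?_⟩
  have h1 := hstep x
  have h2 := hnonneg (A *ᵥ x)
  have h3 : vnorm x ≤ frob (1 - F) * vnorm (N *ᵥ x) := by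
    have := vnorm_mulVec_le (1 - F) (N *ᵥ x)
    rwa [Matrix.mulVec_mulVec, hN1, Matrix.one_mulVec] at this
  have h4 : x ⬝ᵥ x ≤ frob (1 - F) ^ 2 * (N *ᵥ x ⬝ᵥ N *ᵥ x) := by
    rw [← vnorm_sq, ← vnorm_sq, ← mul_pow]
    exact pow_le_pow_left₀ (vnorm_nonneg x) h3 2
  have h5 := dotProduct_self_nonneg' (N *ᵥ x)
  have h6 : 2 * (x ⬝ᵥ x) ≤ q x * (frob (1 - F) ^ 2 + 1) := by nlinarith [sq_nonneg (frob (1 - F))]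
  rw [div_mul_eq_mul_div, div_le_iff₀ (by positivity)]
  exact h6

end Lyapunov

variable {n : ℕ}

/-! ### Eigenvalues of the companion matrices -/

/-- Each row but the last expresses the next entry of the eigenvector through the preceding ones, so
the entry `w 0` cannot vanish. Eliminating the others leaves the characteristic polynomial times `w
0`. -/
theorem companion_three (α w : Fin 3 → ℂ) (z : ℂ) (hw : w ≠ 0)
    (h : ∀ j : Fin 3, ∑ c : Fin 3, (if (c : ℕ) = 0 then -α j
      else if (c : ℕ) = (j : ℕ) + 1 then 1 else 0) * w c = z * w j) :
    z ^ 3 + ∑ j : Fin 3, α j * z ^ (3 - 1 - (j : ℕ)) = 0 := by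
  have h0 := h 0
  have h1 := h 1
  have h2 := h 2
  simp [Fin.sum_univ_three] at h0 h1 h2
  have hw0 : w 0 ≠ 0 := by
    intro e
    apply hw
    have e1 : w 1 = 0 := by linear_combination h0 + (z + α 0) * e
    have e2 : w 2 = 0 := by linear_combination h1 + α 1 * e + z * e1
    ext j
    fin_cases j <;> assumption
  simp [Fin.sum_univ_three]
  apply mul_right_cancel₀ hw0
  linear_combination -(z ^ 2 * h0) - z * h1 - h2

theorem companion_four (α w : Fin 4 → ℂ) (z : ℂ) (hw : w ≠ 0)
    (h : ∀ j : Fin 4, ∑ c : Fin 4, (if (c : ℕ) = 0 then -α j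
      else if (c : ℕ) = (j : ℕ) + 1 then 1 else 0) * w c = z * w j) :
    z ^ 4 + ∑ j : Fin 4, α j * z ^ (4 - 1 - (j : ℕ)) = 0 := by
  have h0 := h 0
  have h1 := h 1
  have h2 := h 2
  have h3 := h 3
  simp [Fin.sum_univ_four] at h0 h1 h2 h3
  have hw0 : w 0 ≠ 0 := by
    intro e
    apply hw
    have e1 : w 1 = 0 := by linear_combination h0 + (z + α 0) * e
    have e2 : w 2 = 0 := by linear_combination h1 + α 1 * e + z * e1
    have e3 : w 3 = 0 := by linear_combination h2 + α 2 * e + z * e2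
    ext j
    fin_cases j <;> assumption
  simp [Fin.sum_univ_four]
  apply mul_right_cancel₀ hw0
  linear_combination -(z ^ 3 * h0) - z ^ 2 * h1 - z * h2 - h3

/-- All blocks are multiples of the identity, so for each fixed spatial component `k` the slice `u
(·, k)` satisfies the scalar companion equations; some slice is nonzero. -/
theorem F_eigenvalue_re_neg (p : Params n) (i : Fin 3) (z : ℂ) (u : Fin (ord i) × Fin 3 → ℂ)
    (hu : u ≠ 0) (h : (F p i).map Complex.ofRealHom *ᵥ u = z • u) : z.re < 0 := by
  have hrow : ∀ (j : Fin (ord i)) (k : Fin 3),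
      ∑ c : Fin (ord i), (if (c : ℕ) = 0 then -(p.α i j : ℂ)
        else if (c : ℕ) = (j : ℕ) + 1 then 1 else 0) * u (c, k) = z * u (j, k) := by
    intro j k
    have := congrFun h (j, k)
    simp only [mulVec, dotProduct, Fintype.sum_prod_type, Matrix.map_apply, F, Matrix.of_apply,
      Pi.smul_apply, smul_eq_mul] at this
    rw [← this]
    refine Finset.sum_congr rfl fun c _ => ?_
    rw [Finset.sum_eq_single k]
    · simp only [if_true]
      split_ifs <;> simp
    · intro b _ hb
      simp [hb.symm]
    · simp
  apply p.hα i z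
  obtain ⟨⟨j, k⟩, hjk⟩ := Function.ne_iff.1 hu
  fin_cases i
  · exact companion_three _ _ z (fun h => hjk (congrFun h j)) fun j => hrow j k
  · exact companion_three _ _ z (fun h => hjk (congrFun h j)) fun j => hrow j k
  · exact companion_four _ _ z (fun h => hjk (congrFun h j)) fun j => hrow j k

theorem exists_coercive (p : Params n) (P : ObsMatrices)
    (hP : ∀ i, P i * F p i + (F p i)ᵀ * P i = -1) :
    ∃ c > 0, ∀ η : Eta, c * ∑ i, η i ⬝ᵥ η i ≤ ∑ i, η i ⬝ᵥ P i *ᵥ η i := by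
  choose c hc h using fun i =>
    coercive_of_lyapunov (F p i) (P i) (fun z u => F_eigenvalue_re_neg p i z u) (hP i)
  obtain ⟨i₀, -, h₀⟩ := Finset.exists_min_image Finset.univ c Finset.univ_nonempty
  refine ⟨c i₀, hc i₀, fun η => ?_⟩
  rw [Finset.mul_sum]
  exact Finset.sum_le_sum fun i _ => (mul_le_mul_of_nonneg_right (h₀ i (Finset.mem_univ i))
    (dotProduct_self_nonneg' _)).trans (h i (η i))

/-! ### The domain of operation -/

/-- The difference of the two sides is the square `‖k₂ x₁ + x₂‖² / (2 k₁ k₂)`. -/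
theorem le_Vquad {k₁ k₂ : ℝ} (h₁ : 0 < k₁) (h₂ : 0 < k₂) (x : Pair) :
    (k₁ + 1) / (2 * k₂) * (x.1 ⬝ᵥ x.1) + 1 / (2 * k₂) * (x.2 ⬝ᵥ x.2) ≤ Vquad k₁ k₂ x := by
  have h := dotProduct_self_nonneg' (k₂ • x.1 + x.2)
  simp only [add_dotProduct, dotProduct_add, smul_dotProduct, dotProduct_smul, smul_eq_mul] at h
  rw [dotProduct_comm x.2 x.1] at h
  have e : Vquad k₁ k₂ x - ((k₁ + 1) / (2 * k₂) * (x.1 ⬝ᵥ x.1) + 1 / (2 * k₂) * (x.2 ⬝ᵥ x.2)) =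
      (k₂ * (k₂ * x.1 ⬝ᵥ x.1) + k₂ * x.1 ⬝ᵥ x.2 + (k₂ * x.1 ⬝ᵥ x.2 + x.2 ⬝ᵥ x.2)) /
        (2 * k₁ * k₂) := by
    rw [Vquad]
    field_simp
    ring
  rw [← sub_nonneg, e]
  exact div_nonneg (by linarith) (by positivity)

/-- The strict inequality `d < δ` is exactly the hypothesis on `cξ`. It makes the sum of reference
and error angles stay uniformly away from `±π/2`, where `Psi` is singular. -/
theorem exists_bound_Ωξ (p : Params n) :
    ∃ d < p.δ, ∃ R > 0, ∀ ξ ∈ Ωξ p, vnorm ξ.1 ≤ d ∧ vnorm ξ.2 ≤ R := by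
  have h₁ := p.hβ₁
  have h₂ := p.hβ₂
  have hc := p.hcξ
  refine ⟨√(2 * p.β₂ * p.cξ / (p.β₁ + 1)), ?_, √(2 * p.β₂ * p.cξ), by positivity,
    fun ξ hξ => ?_⟩
  · rw [Real.sqrt_lt' p.hδ, div_lt_iff₀ (by positivity)]
    have := p.hcξ'
    rw [lt_div_iff₀ (by positivity)] at this
    linarith
  · have hV : Vquad p.β₁ p.β₂ ξ < p.cξ := hξ
    have h := (le_Vquad h₁ h₂ ξ).trans hV.le
    have hX := dotProduct_self_nonneg' ξ.1
    have hZ := dotProduct_self_nonneg' ξ.2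
    rw [div_mul_eq_mul_div, div_mul_eq_mul_div, ← add_div, div_le_iff₀ (by positivity)] at h
    constructor
    · refine Real.sqrt_le_sqrt ?_
      rw [le_div_iff₀ (by positivity)]
      nlinarith
    · refine Real.sqrt_le_sqrt ?_
      nlinarith

theorem continuous_Vquad (k₁ k₂ : ℝ) : Continuous (Vquad k₁ k₂) := by
  unfold Vquad dotProduct
  fun_prop

/-- The subset `Ωsub` keeps a positive distance from the complement of `Ω_ξ`. -/
theorem exists_margin (p : Params n) (Ωsub : Set Pair) (hΩsub : closure Ωsub ⊆ Ωξ p) :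
    ∃ r > 0, ∀ ξ ∈ Ωsub, ∀ ζ : Pair, dist ζ ξ ≤ r → ζ ∈ Ωξ p := by
  obtain ⟨d, -, R, -, hb⟩ := exists_bound_Ωξ p
  have hbdd : Bornology.IsBounded (Ωξ p) := by
    refine (Metric.isBounded_iff_subset_closedBall 0).2 ⟨max d R, fun ξ hξ => ?_⟩
    rw [mem_closedBall_zero_iff, Prod.norm_def]
    exact max_le_max ((norm_le_vnorm _).trans (hb ξ hξ).1) ((norm_le_vnorm _).trans (hb ξ hξ).2)
  have hcomp : IsCompact (closure Ωsub) :=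
    Metric.isCompact_of_isClosed_isBounded isClosed_closure (hbdd.subset hΩsub)
  have hopen : IsOpen (Ωξ p) := isOpen_lt (continuous_Vquad _ _) continuous_const
  obtain ⟨r, hr, h⟩ := hcomp.exists_cthickening_subset_open hopen hΩsub
  exact ⟨r, hr, fun ξ hξ ζ hζ =>
    h (Metric.mem_cthickening_of_dist_le ζ ξ r _ (subset_closure hξ) hζ)⟩

/-- Euler angles with components of modulus at most `a`. -/
def angleBox (a : ℝ) : Set (Fin 3 → ℝ) := {ϑ | ∀ k, |ϑ k| ≤ a}

theorem isCompact_angleBox (a : ℝ) : IsCompact (angleBox a) := by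
  have : angleBox a = Set.pi Set.univ fun _ => Set.Icc (-a) a := by
    ext ϑ
    simp only [angleBox, abs_le, Set.mem_ofPred_eq, Set.mem_pi, Set.mem_univ, true_implies,
      Set.mem_Icc]
  rw [this]
  exact isCompact_univ_pi fun _ => isCompact_Icc

theorem cos_ne_zero_of_mem_angleBox {a : ℝ} (ha : a < Real.pi / 2) {ϑ : Fin 3 → ℝ}
    (hϑ : ϑ ∈ angleBox a) : Real.cos (ϑ 1) ≠ 0 := by
  have := abs_le.1 (hϑ 1)
  exact (Real.cos_pos_of_mem_Ioo ⟨by linarith, by linarith⟩).ne'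

theorem exists_angleBox (p : Params n) :
    ∃ a < Real.pi / 2, ∀ ϑr : Fin 3 → ℝ, (∀ k, |ϑr k| < Real.pi / 2 - p.δ) →
      ∀ ξ ∈ Ωξ p, ϑr + ξ.1 ∈ angleBox a := by
  obtain ⟨d, hd, R, -, hb⟩ := exists_bound_Ωξ p
  refine ⟨Real.pi / 2 - p.δ + d, by linarith, fun ϑr h ξ hξ k => ?_⟩
  have h1 := (abs_apply_le_vnorm ξ.1 k).trans (hb ξ hξ).1
  have h2 := abs_add_le (ϑr k) (ξ.1 k)
  have := h k
  simp only [Pi.add_apply]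
  linarith

/-! ### Continuity of the model functions -/

section Continuity

variable {X : Type*} [TopologicalSpace X] {s : Set X} {ϑ v w : X → Fin 3 → ℝ}

theorem continuousOn_Psi (hϑ : ContinuousOn ϑ s) (hc : ∀ x ∈ s, Real.cos (ϑ x 1) ≠ 0) :
    ContinuousOn (fun x => Psi (ϑ x)) s := by
  have h := fun k => (continuousOn_pi.1 hϑ k)
  have h0 := h 0
  have h1 := h 1
  refine continuousOn_pi.2 fun i => continuousOn_pi.2 fun j => ?_
  fin_cases i <;> fin_cases j <;> simp [Psi, Real.tan_eq_sin_div_cos] <;>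
    fun_prop (disch := assumption)

theorem continuousOn_PsiDot (hϑ : ContinuousOn ϑ s) (hv : ContinuousOn v s)
    (hc : ∀ x ∈ s, Real.cos (ϑ x 1) ≠ 0) :
    ContinuousOn (fun x => PsiDot (ϑ x) (v x)) s := by
  have h0 := continuousOn_pi.1 hϑ 0
  have h1 := continuousOn_pi.1 hϑ 1
  have h2 := continuousOn_pi.1 hv 0
  have h3 := continuousOn_pi.1 hv 1
  have hc2 : ∀ x ∈ s, Real.cos (ϑ x 1) ^ 2 ≠ 0 := fun x hx => pow_ne_zero 2 (hc x hx)
  refine continuousOn_pi.2 fun i => continuousOn_pi.2 fun j => ?_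
  fin_cases i <;> fin_cases j <;> simp [PsiDot, Real.tan_eq_sin_div_cos] <;>
    fun_prop (disch := assumption)

/-- Continuity of the inverse reduces to that of `cos` times the adjugate. -/
theorem det_Psi (ϑ : Fin 3 → ℝ) : (Psi ϑ).det = (Real.cos (ϑ 1))⁻¹ := by
  have h := Real.sin_sq_add_cos_sq (ϑ 0)
  rw [Psi, Matrix.det_fin_three]
  simp
  linear_combination (Real.cos (ϑ 1))⁻¹ * h

theorem continuousOn_Psi_inv (hϑ : ContinuousOn ϑ s) (hc : ∀ x ∈ s, Real.cos (ϑ x 1) ≠ 0) :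
    ContinuousOn (fun x => (Psi (ϑ x))⁻¹) s := by
  have h : (fun x => (Psi (ϑ x))⁻¹) = fun x => Real.cos (ϑ x 1) • (Psi (ϑ x)).adjugate := by
    funext x
    rw [Matrix.inv_def, det_Psi, Ring.inverse_eq_inv', inv_inv]
  rw [h]
  have h1 := continuousOn_pi.1 hϑ 1
  have h2 : ContinuousOn (fun x => (Psi (ϑ x)).adjugate) s :=
    (continuous_id.matrix_adjugate).comp_continuousOn (continuousOn_Psi hϑ hc)
  fun_prop

theorem continuousOn_mulVec {κ ι : Type*} [Fintype κ] {A : X → Matrix ι κ ℝ} {u : X → κ → ℝ}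
    (hA : ContinuousOn A s) (hu : ContinuousOn u s) : ContinuousOn (fun x => A x *ᵥ u x) s := by
  have : Continuous fun y : Matrix ι κ ℝ × (κ → ℝ) => y.1 *ᵥ y.2 :=
    continuous_fst.matrix_mulVec continuous_snd
  exact this.comp_continuousOn (hA.prodMk hu)

theorem continuousOn_matrix_mul {κ ι o : Type*} [Fintype κ] {A : X → Matrix ι κ ℝ}
    {B : X → Matrix κ o ℝ} (hA : ContinuousOn A s) (hB : ContinuousOn B s) :
    ContinuousOn (fun x => A x * B x) s := by
  have : Continuous fun y : Matrix ι κ ℝ × Matrix κ o ℝ => y.1 * y.2 :=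
    continuous_fst.matrix_mul continuous_snd
  exact this.comp_continuousOn (hA.prodMk hB)

theorem continuousOn_crossProduct (hv : ContinuousOn v s) (hw : ContinuousOn w s) :
    ContinuousOn (fun x => crossProduct (v x) (w x)) s := by
  have hv' := fun k => continuousOn_pi.1 hv k
  have hw' := fun k => continuousOn_pi.1 hw k
  refine continuousOn_pi.2 fun i => ?_
  simp only [cross_apply]
  fin_cases i <;> simp <;> fun_prop

theorem continuousOn_f (p : Params n) {ξ : X → Pair} (hξ : ContinuousOn ξ s)
    (hϑ : ContinuousOn ϑ s) (hv : ContinuousOn v s) (hc : ∀ x ∈ s, Real.cos (ϑ x 1) ≠ 0) :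
    ContinuousOn (fun x => f p (ξ x) (ϑ x) (v x)) s := by
  have h1 : ContinuousOn (fun x => (ξ x).2 + v x) s := (continuous_snd.comp_continuousOn hξ).add hv
  have h2 := continuousOn_mulVec (continuousOn_Psi_inv hϑ hc) h1
  have h3 := continuousOn_mulVec (continuousOn_PsiDot hϑ h1 hc) h2
  have h4 := continuousOn_matrix_mul (continuousOn_Psi hϑ hc) (continuousOn_const (c := p.J⁻¹))
  have h5 := continuousOn_crossProduct h2 (continuousOn_mulVec (continuousOn_const (c := p.J)) h2)
  exact h3.sub (continuousOn_mulVec h4 h5)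

theorem continuousOn_Gbar (p : Params n) (hϑ : ContinuousOn ϑ s)
    (hc : ∀ x ∈ s, Real.cos (ϑ x 1) ≠ 0) (i : Fin 3) :
    ContinuousOn (fun x => Gbar p (ϑ x) i) s := by
  have h4 := continuousOn_matrix_mul (continuousOn_Psi hϑ hc) (continuousOn_const (c := p.J⁻¹))
  have h0 := continuousOn_pi.1 hϑ 0
  have h1 := continuousOn_pi.1 hϑ 1
  have h2 := continuousOn_pi.1 hϑ 2
  fin_cases i
  · refine ContinuousOn.const_smul (continuousOn_matrix_mul ?_ continuousOn_const) p.b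
    refine continuousOn_pi.2 fun k => continuousOn_pi.2 fun l => ?_
    refine Fin.cases ?_ (fun l => ?_) l
    · fin_cases k <;> simp [R3] <;> fun_prop
    · simpa using continuousOn_const
  · refine ContinuousOn.const_smul (continuousOn_matrix_mul ?_ continuousOn_const) p.b
    refine continuousOn_pi.2 fun k => continuousOn_pi.2 fun l => ?_
    refine Fin.cases ?_ (fun l => ?_) l
    · simpa using continuousOn_const
    · simpa using continuousOn_pi.1 (continuousOn_pi.1 h4 k) l
  · exact continuousOn_const

end Continuity

/-! ### Uniform bounds on compact sets of Euler angles -/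

theorem exists_frob_le {κ ι : Type*} [Fintype κ] [Fintype ι] {a : ℝ}
    {A : (Fin 3 → ℝ) → Matrix ι κ ℝ} (hA : ContinuousOn A (angleBox a)) :
    ∃ K, 0 ≤ K ∧ ∀ ϑ ∈ angleBox a, ∀ v, vnorm (A ϑ *ᵥ v) ≤ K * vnorm v := by
  obtain ⟨K, hK⟩ := (isCompact_angleBox a).exists_bound_of_continuousOn (continuousOn_frob hA)
  refine ⟨max K 0, le_max_right _ _, fun ϑ hϑ v => (vnorm_mulVec_le _ _).trans ?_⟩
  have := (le_abs_self _).trans ((hK ϑ hϑ).trans (le_max_left K 0))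
  exact mul_le_mul_of_nonneg_right this (vnorm_nonneg v)

theorem exists_Gbar_bound (p : Params n) {a : ℝ} (ha : a < Real.pi / 2) :
    ∃ K, 0 ≤ K ∧ ∀ ϑ ∈ angleBox a, ∀ i w, vnorm (Gbar p ϑ i *ᵥ w) ≤ K * vnorm w := by
  have h := fun i => exists_frob_le (continuousOn_Gbar p continuousOn_id
    (fun ϑ hϑ => cos_ne_zero_of_mem_angleBox ha hϑ) i)
  choose K hK0 hK using h
  refine ⟨∑ i, K i, Finset.sum_nonneg fun i _ => hK0 i, fun ϑ hϑ i w => (hK i ϑ hϑ w).trans ?_⟩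
  exact mul_le_mul_of_nonneg_right
    (Finset.single_le_sum (fun i _ => hK0 i) (Finset.mem_univ i)) (vnorm_nonneg w)

/-- Lagrange's identity: `‖u × v‖² = ‖u‖² ‖v‖² - (u ⬝ v)²`. -/
theorem vnorm_crossProduct_le (u v : Fin 3 → ℝ) :
    vnorm (crossProduct u v) ≤ vnorm u * vnorm v := by
  rw [vnorm, vnorm, vnorm, ← Real.sqrt_mul (dotProduct_self_nonneg' u)]
  refine Real.sqrt_le_sqrt ?_
  rw [cross_dot_cross, dotProduct_comm v u]
  nlinarith [mul_self_nonneg (u ⬝ᵥ v)]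

/-- The bilinear map whose diagonal is the rotational drift. -/
def fBilin (p : Params n) (ϑ v w : Fin 3 → ℝ) : Fin 3 → ℝ :=
  PsiDot ϑ v *ᵥ ((Psi ϑ)⁻¹ *ᵥ w)
    - (Psi ϑ * p.J⁻¹) *ᵥ (crossProduct ((Psi ϑ)⁻¹ *ᵥ v) (p.J *ᵥ ((Psi ϑ)⁻¹ *ᵥ w)))

/-- The drift is quadratic in the rate, so `B(v, v) - B(w, w) = B(v, v - w) + B(v - w, w)`. Both
terms are linear in the difference, with one factor bounded by the rates. -/
theorem f_sub_f (p : Params n) (ξ ζ : Pair) (ϑ r : Fin 3 → ℝ) :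
    f p ξ ϑ r - f p ζ ϑ r =
      fBilin p ϑ (ξ.2 + r) (ξ.2 - ζ.2) + fBilin p ϑ (ξ.2 - ζ.2) (ζ.2 + r) := by
  have e : ξ.2 - ζ.2 = (ξ.2 + r) - (ζ.2 + r) := by abel
  rw [e]
  simp only [f]
  generalize ξ.2 + r = v
  generalize ζ.2 + r = w
  have hd : PsiDot ϑ (v - w) = PsiDot ϑ v - PsiDot ϑ w := by
    simp only [PsiDot, Pi.sub_apply, sub_smul]
    abel
  simp only [fBilin, hd, Matrix.mulVec_sub, map_sub, LinearMap.sub_apply, Matrix.sub_mulVec]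
  abel

theorem exists_fBilin_bound (p : Params n) {a : ℝ} (ha : a < Real.pi / 2) :
    ∃ K, 0 ≤ K ∧ ∀ ϑ ∈ angleBox a, ∀ v w, vnorm (fBilin p ϑ v w) ≤ K * (vnorm v * vnorm w) := by
  have hc : ∀ ϑ ∈ angleBox a, Real.cos (ϑ 1) ≠ 0 := fun ϑ hϑ => cos_ne_zero_of_mem_angleBox ha hϑ
  obtain ⟨K₁, h₁, H₁⟩ := exists_frob_le (continuousOn_PsiDot continuousOn_id
    (continuousOn_const (c := ![1, 0, 0])) hc)
  obtain ⟨K₂, h₂, H₂⟩ := exists_frob_le (continuousOn_PsiDot continuousOn_id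
    (continuousOn_const (c := ![0, 1, 0])) hc)
  obtain ⟨K₃, h₃, H₃⟩ := exists_frob_le (continuousOn_Psi_inv continuousOn_id hc)
  obtain ⟨K₄, h₄, H₄⟩ := exists_frob_le
    (continuousOn_matrix_mul (continuousOn_Psi continuousOn_id hc) (continuousOn_const (c := p.J⁻¹)))
  have h₅ := frob_nonneg p.J
  refine ⟨(K₁ + K₂) * K₃ + K₄ * (K₃ * (frob p.J * K₃)), by positivity, fun ϑ hϑ v w => ?_⟩
  -- Linearity in the rate reduces the bound to two matrix functions of the angles alone, which are
  -- bounded on the compact box.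
  have hd : PsiDot ϑ v = v 0 • PsiDot ϑ ![1, 0, 0] + v 1 • PsiDot ϑ ![0, 1, 0] := by
    simp [PsiDot]
  have hv := vnorm_nonneg v
  have hw := vnorm_nonneg w
  have e₃ := H₃ ϑ hϑ w
  have e₁ : vnorm (PsiDot ϑ v *ᵥ ((Psi ϑ)⁻¹ *ᵥ w)) ≤ (K₁ + K₂) * K₃ * (vnorm v * vnorm w) := by
    rw [hd, Matrix.add_mulVec, Matrix.smul_mulVec, Matrix.smul_mulVec]
    refine (vnorm_add_le _ _).trans ?_
    rw [vnorm_smul, vnorm_smul]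
    have a₁ := (H₁ ϑ hϑ ((Psi ϑ)⁻¹ *ᵥ w)).trans (mul_le_mul_of_nonneg_left e₃ h₁)
    have a₂ := (H₂ ϑ hϑ ((Psi ϑ)⁻¹ *ᵥ w)).trans (mul_le_mul_of_nonneg_left e₃ h₂)
    have b₁ := mul_le_mul (abs_apply_le_vnorm v 0) a₁ (vnorm_nonneg _) hv
    have b₂ := mul_le_mul (abs_apply_le_vnorm v 1) a₂ (vnorm_nonneg _) hv
    simp only [id] at b₁ b₂ ⊢
    linarith
  have e₂ : vnorm ((Psi ϑ * p.J⁻¹) *ᵥ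
      (crossProduct ((Psi ϑ)⁻¹ *ᵥ v) (p.J *ᵥ ((Psi ϑ)⁻¹ *ᵥ w)))) ≤
      K₄ * (K₃ * (frob p.J * K₃)) * (vnorm v * vnorm w) := by
    refine (H₄ ϑ hϑ _).trans ?_
    have a₁ := (vnorm_mulVec_le p.J ((Psi ϑ)⁻¹ *ᵥ w)).trans (mul_le_mul_of_nonneg_left e₃ h₅)
    have a₂ := (vnorm_crossProduct_le ((Psi ϑ)⁻¹ *ᵥ v) (p.J *ᵥ ((Psi ϑ)⁻¹ *ᵥ w))).trans
      (mul_le_mul (H₃ ϑ hϑ v) a₁ (vnorm_nonneg _) (by positivity))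
    have := mul_le_mul_of_nonneg_left a₂ h₄
    linarith
  refine (vnorm_sub_le _ _).trans ?_
  linarith

/-- The rotational drift is Lipschitz in the rate, uniformly in the Euler angles. -/
theorem exists_f_lipschitz (p : Params n) {a : ℝ} (ha : a < Real.pi / 2) :
    ∃ K, 0 ≤ K ∧ ∀ S, ∀ ϑ ∈ angleBox a, ∀ r, vnorm r ≤ p.aθ → ∀ ξ ζ : Pair,
      vnorm ξ.2 ≤ S → vnorm ζ.2 ≤ S →
        vnorm (f p ξ ϑ r - f p ζ ϑ r) ≤ K * (S + p.aθ) * vnorm (ξ.2 - ζ.2) := by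
  obtain ⟨K, hK, H⟩ := exists_fBilin_bound p ha
  refine ⟨2 * K, by positivity, fun S ϑ hϑ r hr ξ ζ hξ hζ => ?_⟩
  rw [f_sub_f]
  refine (vnorm_add_le _ _).trans ?_
  have h₁ : vnorm (ξ.2 + r) ≤ S + p.aθ := (vnorm_add_le _ _).trans (add_le_add hξ hr)
  have h₂ : vnorm (ζ.2 + r) ≤ S + p.aθ := (vnorm_add_le _ _).trans (add_le_add hζ hr)
  have e₁ := (H ϑ hϑ (ξ.2 + r) (ξ.2 - ζ.2)).trans (mul_le_mul_of_nonneg_left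
    (mul_le_mul_of_nonneg_right h₁ (vnorm_nonneg _)) hK)
  have e₂ := (H ϑ hϑ (ξ.2 - ζ.2) (ζ.2 + r)).trans (mul_le_mul_of_nonneg_left
    (mul_le_mul_of_nonneg_left h₂ (vnorm_nonneg _)) hK)
  linarith

/-! ### Norms of the error state -/

/-- Euclidean norm of the scaled observer errors. -/
def etaNorm (η : Eta) : ℝ := √(∑ i, η i ⬝ᵥ η i)

theorem etaNorm_nonneg (η : Eta) : 0 ≤ etaNorm η := Real.sqrt_nonneg _

theorem etaNorm_sq (η : Eta) : etaNorm η ^ 2 = ∑ i, η i ⬝ᵥ η i :=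
  Real.sq_sqrt (Finset.sum_nonneg fun _ _ => dotProduct_self_nonneg' _)

theorem vnorm_le_etaNorm (η : Eta) (i : Fin 3) : vnorm (η i) ≤ etaNorm η :=
  Real.sqrt_le_sqrt (Finset.single_le_sum (f := fun i => η i ⬝ᵥ η i)
    (fun _ _ => dotProduct_self_nonneg' _) (Finset.mem_univ i))

theorem vnorm_block_le_etaNorm (η : Eta) (i : Fin 3) (j : Fin (ord i)) :
    vnorm (fun k => η i (j, k)) ≤ etaNorm η :=
  (vnorm_comp_le (η i) (fun k => (j, k)) fun _ _ h => (Prod.mk.inj h).2).trans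
    (vnorm_le_etaNorm η i)

theorem exists_etaNorm_le : ∃ c, 0 ≤ c ∧ ∀ η : Eta, etaNorm η ≤ c * ‖η‖ := by
  refine ⟨√(∑ i, (√(Fintype.card (Fin (ord i) × Fin 3))) ^ 2), by positivity, fun η => ?_⟩
  rw [← Real.sqrt_sq (norm_nonneg η), ← Real.sqrt_mul (by positivity), Finset.sum_mul]
  refine Real.sqrt_le_sqrt (Finset.sum_le_sum fun i _ => ?_)
  rw [← vnorm_sq, ← mul_pow]
  refine pow_le_pow_left₀ (vnorm_nonneg _) ((vnorm_le_card_mul_norm _).trans ?_) 2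
  exact mul_le_mul_of_nonneg_left (norm_le_pi_norm η i) (Real.sqrt_nonneg _)

theorem stateNorm_sq (Δ : State n) :
    stateNorm Δ ^ 2 = etaNorm Δ.1 ^ 2 + Δ.2.1 ⬝ᵥ Δ.2.1 + Δ.2.2 ⬝ᵥ Δ.2.2 := by
  rw [etaNorm_sq]
  exact Real.sq_sqrt (add_nonneg (add_nonneg
    (Finset.sum_nonneg fun _ _ => dotProduct_self_nonneg' _) (dotProduct_self_nonneg' _))
    (dotProduct_self_nonneg' _))

theorem stateNorm_nonneg (Δ : State n) : 0 ≤ stateNorm Δ := Real.sqrt_nonneg _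

/-! ### Lipschitz estimate for the nominal drift -/

theorem xiHat_zero (ε : ℝ) (ξ : Pair) : xiHat ε ξ 0 = ξ := by
  refine Prod.ext ?_ ?_ <;> ext k <;> simp [xiHat]

theorem xc3Hat_zero (ε : ℝ) (x : Fin 3 → ℝ) : xc3Hat ε x 0 = x := by
  ext k
  simp [xc3Hat]

theorem vnorm_xiHat_sub (ε : ℝ) (ξ : Pair) (η ζ : Eta) :
    vnorm ((xiHat ε ξ η).2 - (xiHat ε ξ ζ).2) ≤ |ε| * etaNorm (η - ζ) := by
  have e : (xiHat ε ξ η).2 - (xiHat ε ξ ζ).2 =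
      (-ε) • fun k => (η - ζ) 1 (⟨1, by decide⟩, k) := by
    ext k
    simp [xiHat]
    ring
  rw [e, vnorm_smul, abs_neg]
  exact mul_le_mul_of_nonneg_left (vnorm_block_le_etaNorm (η - ζ) 1 _) (abs_nonneg _)

theorem vnorm_xc3Hat_sub (ε : ℝ) (x : Fin 3 → ℝ) (η ζ : Eta) :
    vnorm (xc3Hat ε x η - xc3Hat ε x ζ) ≤ |ε| * etaNorm (η - ζ) := by
  have e : xc3Hat ε x η - xc3Hat ε x ζ = (-ε) • fun k => (η - ζ) 2 (⟨2, by decide⟩, k) := by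
    ext k
    simp [xc3Hat]
    ring
  rw [e, vnorm_smul, abs_neg]
  exact mul_le_mul_of_nonneg_left (vnorm_block_le_etaNorm (η - ζ) 2 _) (abs_nonneg _)

/-- The difference of the nominal drifts at two observer errors. -/
theorem exists_fbar_lipschitz (p : Params n) {a : ℝ} (ha : a < Real.pi / 2) :
    ∃ K, 0 ≤ K ∧ ∀ S, 0 ≤ S → ∀ ϑ ∈ angleBox a, ∀ r, vnorm r ≤ p.aθ →
      ∀ (ε : ℝ) (ξ : Pair) (x : Fin 3 → ℝ) (η ζ : Eta),
      vnorm (xiHat ε ξ η).2 ≤ S → vnorm (xiHat ε ξ ζ).2 ≤ S → ∀ i,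
        vnorm (fbar p (xiHat ε ξ η) (xc3Hat ε x η) ϑ r i
          - fbar p (xiHat ε ξ ζ) (xc3Hat ε x ζ) ϑ r i) ≤
        (1 + K * (S + p.aθ)) * (|ε| * etaNorm (η - ζ)) := by
  obtain ⟨K, hK, H⟩ := exists_f_lipschitz p ha
  refine ⟨K, hK, fun S hS ϑ hϑ r hr ε ξ x η ζ hη hζ i => ?_⟩
  have hθ := p.haθ
  have h0 : 0 ≤ |ε| * etaNorm (η - ζ) := mul_nonneg (abs_nonneg _) (etaNorm_nonneg _)
  have hKS : 0 ≤ K * (S + p.aθ) := by positivity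
  fin_cases i
  · have := vnorm_xc3Hat_sub ε x η ζ
    have e : (![0, 0, p.g] - xc3Hat ε x η) - (![0, 0, p.g] - xc3Hat ε x ζ) =
      -(xc3Hat ε x η - xc3Hat ε x ζ) := by abel
    simp only [fbar, Fin.zero_eta, Matrix.cons_val_zero]
    rw [e, vnorm_neg]
    nlinarith
  · have h1 := H S ϑ hϑ r hr _ _ hη hζ
    have h2 := mul_le_mul_of_nonneg_left (vnorm_xiHat_sub ε ξ η ζ) hKS
    simp only [fbar, Fin.mk_one, Matrix.cons_val_one, Matrix.cons_val_zero]
    nlinarith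
  · simp only [fbar, Fin.reduceFinMk, Matrix.cons_val, sub_self, vnorm_zero]
    positivity

/-! ### Dissipation of the observer and actuator errors -/

/-- `∑ᵢ (ηⁱ)ᵀ Pⁱ ηⁱ`. -/
def obsForm (P : ObsMatrices) (η : Eta) : ℝ := ∑ i, η i ⬝ᵥ (P i *ᵥ η i)

/-- Derivative of `obsForm P` at `η` in the direction `ζ`. -/
def obsFormDeriv (P : ObsMatrices) (η ζ : Eta) : ℝ :=
  ∑ i, (ζ i ⬝ᵥ (P i *ᵥ η i) + η i ⬝ᵥ (P i *ᵥ ζ i))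

/-- Derivative of `Vω d₂` at `w` in the direction `z`. -/
def VωDeriv (d₂ : ℝ) (w z : (Fin n → ℝ) × (Fin n → ℝ)) : ℝ :=
  2 * d₂ * (w.1 ⬝ᵥ z.1) + 2 * (w.2 ⬝ᵥ z.2)

theorem exists_obsForm_le (P : ObsMatrices) :
    ∃ c > 0, ∀ η : Eta, obsForm P η ≤ c * etaNorm η ^ 2 := by
  refine ⟨∑ i, frob (P i) + 1,
    add_pos_of_nonneg_of_pos (Finset.sum_nonneg fun _ _ => frob_nonneg _) one_pos, fun η => ?_⟩
  have : obsForm P η ≤ ∑ i, frob (P i) * etaNorm η ^ 2 := by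
    refine Finset.sum_le_sum fun i _ =>
      (le_abs_self _).trans ((abs_dotProduct_mulVec_le _ _ _).trans ?_)
    rw [sq]
    have := vnorm_le_etaNorm η i
    have := vnorm_nonneg (η i)
    have := etaNorm_nonneg η
    exact mul_le_mul_of_nonneg_left (by gcongr) (frob_nonneg _)
  rw [← Finset.sum_mul] at this
  nlinarith [sq_nonneg (etaNorm η)]

theorem lyapunov_pairing {ι : Type*} [Fintype ι] [DecidableEq ι] {F P : Matrix ι ι ℝ}
    (hP : P * F + Fᵀ * P = -1) (u : ι → ℝ) :
    F *ᵥ u ⬝ᵥ P *ᵥ u + u ⬝ᵥ P *ᵥ F *ᵥ u = -(u ⬝ᵥ u) := by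
  have := congrArg (fun B : Matrix ι ι ℝ => u ⬝ᵥ B *ᵥ u) hP
  simp only [Matrix.add_mulVec, dotProduct_add, ← Matrix.mulVec_mulVec, Matrix.neg_mulVec,
    Matrix.one_mulVec, dotProduct_neg] at this
  rw [← this, Matrix.dotProduct_mulVec u Fᵀ, Matrix.vecMul_transpose, add_comm]

/-- One channel of the observer: forced companion dynamics. -/
theorem channel_deriv_le (p : Params n) (P : ObsMatrices)
    (hP : ∀ i, P i * F p i + (F p i)ᵀ * P i = -1) (i : Fin 3) {ε : ℝ} (hε : 0 < ε)
    (x : Fin (ord i) × Fin 3 → ℝ) (u w : Fin 3 → ℝ) {A : ℝ} (hA : vnorm u + ε * vnorm w ≤ A) :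
    ε * ((ε⁻¹ • (F p i *ᵥ x + B₁ i *ᵥ u + ε • (B₂ i *ᵥ w))) ⬝ᵥ (P i *ᵥ x)
      + x ⬝ᵥ (P i *ᵥ (ε⁻¹ • (F p i *ᵥ x + B₁ i *ᵥ u + ε • (B₂ i *ᵥ w))))) ≤
    -(x ⬝ᵥ x) + 2 * frob (P i) * (frob (B₁ i) + frob (B₂ i)) * (A * vnorm x) := by
  have hb : vnorm (B₁ i *ᵥ u + ε • (B₂ i *ᵥ w)) ≤ (frob (B₁ i) + frob (B₂ i)) * A := by
    refine (vnorm_add_le _ _).trans ?_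
    rw [vnorm_smul, abs_of_pos hε]
    have h1 := vnorm_mulVec_le (B₁ i) u
    have h2 := mul_le_mul_of_nonneg_left (vnorm_mulVec_le (B₂ i) w) hε.le
    have h3 := frob_nonneg (B₁ i)
    have h4 := frob_nonneg (B₂ i)
    have h5 := vnorm_nonneg u
    have h6 := mul_nonneg hε.le (vnorm_nonneg w)
    have h7 := mul_le_mul_of_nonneg_left hA h3
    have h8 := mul_le_mul_of_nonneg_left hA h4
    nlinarith [mul_nonneg h3 h6, mul_nonneg h4 h5]
  rw [add_assoc]
  generalize B₁ i *ᵥ u + ε • (B₂ i *ᵥ w) = b at hb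
  have e : ε * ((ε⁻¹ • (F p i *ᵥ x + b)) ⬝ᵥ (P i *ᵥ x)
      + x ⬝ᵥ (P i *ᵥ (ε⁻¹ • (F p i *ᵥ x + b)))) =
      (F p i *ᵥ x ⬝ᵥ P i *ᵥ x + x ⬝ᵥ P i *ᵥ F p i *ᵥ x)
        + (b ⬝ᵥ P i *ᵥ x + x ⬝ᵥ P i *ᵥ b) := by
    simp only [smul_dotProduct, Matrix.mulVec_smul, dotProduct_smul, smul_eq_mul,
      Matrix.mulVec_add, add_dotProduct, dotProduct_add]
    field_simp
    ring
  rw [e, lyapunov_pairing (hP i)]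
  have h1 := (le_abs_self _).trans (abs_dotProduct_mulVec_le (P i) b x)
  have h2 := (le_abs_self _).trans (abs_dotProduct_mulVec_le (P i) x b)
  have h3 := mul_le_mul_of_nonneg_left (mul_le_mul_of_nonneg_right hb (vnorm_nonneg x))
    (frob_nonneg (P i))
  linarith

theorem BoundedBy.vnorm_le {p : Params n} {φ : Disturbance} {κ : ℝ} (hφ : BoundedBy p φ κ)
    {Ωsub : Set Pair} (hΩsub : closure Ωsub ⊆ Ωξ p) {s : Signals n} (hs : s.Admissible p Ωsub)
    {t : ℝ} (ht : 0 ≤ t) (i : Fin 3) : vnorm (φ t (s.ρ t, s.ξ t) (s.xc t) i) ≤ κ :=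
  (Real.sqrt_le_sqrt (Finset.single_le_sum
    (f := fun i => φ t (s.ρ t, s.ξ t) (s.xc t) i ⬝ᵥ φ t (s.ρ t, s.ξ t) (s.xc t) i)
    (fun _ _ => dotProduct_self_nonneg' _) (Finset.mem_univ i))).trans
  (hφ.2 t ht _ (hs.mem_ρ t ht) _ (hΩsub (subset_closure (hs.mem_ξ t ht))) _
    (hs.bound_xc₁ t ht) (hs.bound_xc₂ t ht))

/-- Dissipation inequality for the scaled observer errors, valid while the rate estimation error
is bounded by `S`. -/
theorem exists_observer_dissipation (p : Params n) (P : ObsMatrices)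
    (hP : ∀ i, P i * F p i + (F p i)ᵀ * P i = -1) (Ωsub : Set Pair)
    (hΩsub : closure Ωsub ⊆ Ωξ p) (S : ℝ) (hS : 0 < S) :
    ∃ C₁ > 0, ∃ C₂ > 0, ∃ ε₀ > 0, ∀ ε, 0 < ε → ε ≤ ε₀ → ∀ κ (φ : Disturbance), BoundedBy p φ κ →
      ∀ s : Signals n, s.Admissible p Ωsub → ∀ t, 0 ≤ t → ∀ Δ : State n,
      vnorm (s.ξ t).2 ≤ S → vnorm (xiHat ε (s.ξ t) Δ.1).2 ≤ S →
      ε * obsFormDeriv P Δ.1 (rhs p φ s ε t Δ).1 ≤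
        -(1 / 2) * etaNorm Δ.1 ^ 2 + C₁ * (Δ.2.1 ⬝ᵥ Δ.2.1) + C₂ * (ε ^ 2 * κ ^ 2) := by
  obtain ⟨a, ha, hbox⟩ := exists_angleBox p
  obtain ⟨K, hK, hf⟩ := exists_fbar_lipschitz p ha
  obtain ⟨G, hG0, hG⟩ := exists_Gbar_bound p ha
  set L := 1 + K * (S + p.aθ) with hL
  have hL0 : 0 < L := by have := p.haθ; positivity
  set M := ∑ i, 2 * frob (P i) * (frob (B₁ i) + frob (B₂ i)) with hM
  have hMi : ∀ i ∈ (Finset.univ : Finset (Fin 3)),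
      0 ≤ 2 * frob (P i) * (frob (B₁ i) + frob (B₂ i)) := fun i _ => by
    have := frob_nonneg (P i)
    have := frob_nonneg (B₁ i)
    have := frob_nonneg (B₂ i)
    positivity
  have hM0 : 0 ≤ M := Finset.sum_nonneg hMi
  -- The bound on `ε` gives `M L ε ≤ 1/4`. The two forcing terms cost `1/8` of `N²` each by Young's
  -- inequality, which leaves `1/2`.
  refine ⟨2 * M ^ 2 * G ^ 2 + 1, by positivity, 2 * M ^ 2 + 1, by positivity,
    1 / (4 * (M * L + 1)), by positivity,
    fun ε hε hε₀ κ φ hφ s hs t ht Δ hξ hξ' => ?_⟩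
  have hϑ := hbox _ (hs.bound_ϑr t ht) _ (hΩsub (subset_closure (hs.mem_ξ t ht)))
  set N := etaNorm Δ.1 with hN
  have hN0 : 0 ≤ N := etaNorm_nonneg _
  set w := vnorm Δ.2.1 with hw
  have hw0 : 0 ≤ w := vnorm_nonneg _
  have hi : ∀ i, ε * ((rhs p φ s ε t Δ).1 i ⬝ᵥ (P i *ᵥ Δ.1 i)
      + Δ.1 i ⬝ᵥ (P i *ᵥ (rhs p φ s ε t Δ).1 i)) ≤
      -(Δ.1 i ⬝ᵥ Δ.1 i) + 2 * frob (P i) * (frob (B₁ i) + frob (B₂ i)) *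
        ((L * (ε * N) + G * w + ε * κ) * N) := by
    intro i
    have hu := hf S hS.le _ hϑ _ (hs.bound_ϑr' t ht) ε (s.ξ t) (s.xc₃ t) 0 Δ.1
      (by rwa [xiHat_zero]) hξ' i
    rw [xiHat_zero, xc3Hat_zero, ← hL, abs_of_pos hε, zero_sub] at hu
    have hneg : etaNorm (-Δ.1) = N := by simp [etaNorm, hN]
    rw [hneg] at hu
    have hg := hG _ hϑ i Δ.2.1
    have hk := mul_le_mul_of_nonneg_left (hφ.vnorm_le hΩsub hs ht i) hε.le
    have hA := (add_le_add (vnorm_add_le _ _) hk).trans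
      (add_le_add_left (add_le_add hu hg) (ε * κ))
    have := channel_deriv_le p P hP i hε (Δ.1 i) _ _ hA
    refine this.trans ?_
    have hA0 : 0 ≤ L * (ε * N) + G * w + ε * κ :=
      le_trans (add_nonneg (vnorm_nonneg _) (mul_nonneg hε.le (vnorm_nonneg _))) hA
    exact add_le_add_right (mul_le_mul_of_nonneg_left
      (mul_le_mul_of_nonneg_left (vnorm_le_etaNorm Δ.1 i) hA0) (hMi i (Finset.mem_univ i))) _
  have hsum : ε * obsFormDeriv P Δ.1 (rhs p φ s ε t Δ).1 ≤
      -N ^ 2 + M * ((L * (ε * N) + G * w + ε * κ) * N) := by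
    rw [obsFormDeriv, Finset.mul_sum]
    refine (Finset.sum_le_sum fun i _ => hi i).trans ?_
    rw [Finset.sum_add_distrib, ← Finset.sum_mul, Finset.sum_neg_distrib, ← etaNorm_sq]
  have hsmall : M * L * ε ≤ 1 / 4 := by
    rw [le_div_iff₀ (by positivity)] at hε₀
    have : 0 ≤ M * L := by positivity
    nlinarith
  rw [← vnorm_sq]
  have q1 : M * L * ε * N ^ 2 ≤ 1 / 4 * N ^ 2 := mul_le_mul_of_nonneg_right hsmall (sq_nonneg N)
  have q2 := sq_nonneg (N - 4 * (M * G * w))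
  have q3 := sq_nonneg (N - 4 * (M * ε * κ))
  have q4 := sq_nonneg w
  have q5 := sq_nonneg (ε * κ)
  change _ ≤ -(1 / 2) * N ^ 2 + (2 * M ^ 2 * G ^ 2 + 1) * w ^ 2 + _
  linarith

/-- Componentwise, the cross term is absorbed by the square `2 d₂ (a - r b)²` together with `2 d₂ r²
≤ 1`. This is the origin of the upper bound on `d₂`. -/
theorem VωDeriv_rhs_le (p : Params n) {Ωsub : Set Pair} {s : Signals n} (hs : s.Admissible p Ωsub)
    (φ : Disturbance) (ε : ℝ) {t : ℝ} (ht : 0 ≤ t) {d₂ : ℝ} (h0 : 0 ≤ d₂)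
    (h1 : 2 * d₂ * p.ωmax ^ 2 ≤ 1) (Δ : State n) :
    VωDeriv d₂ Δ.2 (rhs p φ s ε t Δ).2 ≤
      -(p.τm⁻¹ * (2 * d₂ * (Δ.2.1 ⬝ᵥ Δ.2.1) + Δ.2.2 ⬝ᵥ Δ.2.2)) := by
  have hτ : 0 < p.τm⁻¹ := inv_pos.2 p.hτm
  simp only [VωDeriv, rhs, dotProduct, Finset.mul_sum, ← Finset.sum_add_distrib,
    ← Finset.sum_neg_distrib]
  refine Finset.sum_le_sum fun k _ => ?_
  simp only [Pi.smul_apply, Pi.add_apply, Pi.neg_apply, Matrix.mulVec_diagonal, smul_eq_mul]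
  have hr0 := Real.sqrt_nonneg (s.ωsd t k)
  have hr := hs.bound_ωsd t ht k
  generalize √(s.ωsd t k) = r at hr0 hr
  generalize Δ.2.1 k = a
  generalize Δ.2.2 k = b
  have hr2 : 2 * d₂ * r ^ 2 ≤ 1 :=
    (mul_le_mul_of_nonneg_left (pow_le_pow_left₀ hr0 hr 2) (by positivity)).trans h1
  have q1 := mul_le_mul_of_nonneg_right hr2 (sq_nonneg b)
  have q2 := mul_nonneg h0 (sq_nonneg (a - r * b))
  have : -4 * d₂ * a ^ 2 + 4 * d₂ * r * a * b - 2 * b ^ 2 ≤ -(2 * d₂ * a ^ 2 + b ^ 2) := by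
    nlinarith
  have := mul_le_mul_of_nonneg_left this hτ.le
  linarith

/-! ### The level `c_Δ` -/

theorem VΔ_eq (P : ObsMatrices) (d₂ d₃ ε : ℝ) (Δ : State n) :
    VΔ P d₂ d₃ ε Δ = d₃ * (ε⁻¹ * obsForm P Δ.1) + Vω d₂ Δ.2 := rfl

theorem VΔ_smul (P : ObsMatrices) (d₂ d₃ ε c : ℝ) (Δ : State n) :
    VΔ P d₂ d₃ ε (c • Δ) = c ^ 2 * VΔ P d₂ d₃ ε Δ := by
  have h : obsForm P (c • Δ).1 = c ^ 2 * obsForm P Δ.1 := by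
    simp only [obsForm, Prod.smul_fst, Pi.smul_apply, smul_dotProduct, Matrix.mulVec_smul,
      dotProduct_smul, smul_eq_mul, Finset.mul_sum]
    exact Finset.sum_congr rfl fun i _ => by ring
  rw [VΔ_eq, VΔ_eq, h]
  simp only [Vω, Prod.smul_fst, Prod.smul_snd, smul_dotProduct, dotProduct_smul, smul_eq_mul]
  ring

theorem Vω_nonneg {d₂ : ℝ} (h : 0 ≤ d₂) (w : (Fin n → ℝ) × (Fin n → ℝ)) : 0 ≤ Vω d₂ w :=
  add_nonneg (mul_nonneg h (dotProduct_self_nonneg' _)) (dotProduct_self_nonneg' _)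

/-- On `Ω_Δ` the rate estimates stay in a bounded set. -/
theorem vnorm_xiHat_le_of_mem_ΩΔ {p : Params n} {Ωsub : Set Pair} (hΩsub : closure Ωsub ⊆ Ωξ p)
    {P : ObsMatrices} {d₂ d₃ cω ε R : ℝ} (hR : ∀ ξ ∈ Ωξ p, vnorm ξ.2 ≤ R)
    (hc : 0 < cΔ p Ωsub P d₂ d₃ cω ε)
    {Δ : State n} (hΔ : Δ ∈ ΩΔ p Ωsub P d₂ d₃ cω ε) {ξ : Pair} (hξ : ξ ∈ Ωsub) :
    vnorm (xiHat ε ξ Δ.1).2 ≤ 3 * R := by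
  -- The supremum `cΔ` need not be attained, so `Ω_Δ` itself need not lie in `Ω_η × Ω_ω`. The halved
  -- state has a quarter of the value, hence lies in an admissible sublevel set; as `ξ̂` is affine
  -- in `η`, its value at the full state is `2 ξ̂ - ξ`, of norm at most `2R + R`.
  have hV : VΔ P d₂ d₃ ε ((1 / 2 : ℝ) • Δ) < cΔ p Ωsub P d₂ d₃ cω ε := by
    rw [VΔ_smul]
    have : VΔ P d₂ d₃ ε Δ ≤ cΔ p Ωsub P d₂ d₃ cω ε := hΔ
    linarith
  -- The supremum of the empty set is 0 in `ℝ`, which would contradict `0 < cΔ`.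
  have hne : {c : ℝ | 0 < c ∧ {Δ : State n | VΔ P d₂ d₃ ε Δ ≤ c} ⊆
      Ωη p Ωsub ε ×ˢ Ωω n d₂ cω}.Nonempty := by
    by_contra h
    rw [Set.not_nonempty_iff_eq_empty] at h
    rw [cΔ, h, Real.sSup_empty] at hc
    exact lt_irrefl _ hc
  obtain ⟨c, hcm, hlt⟩ := exists_lt_of_lt_csSup hne hV
  have h1 := hR _ ((hcm.2 hlt.le).1 ξ hξ)
  have h2 := hR ξ (hΩsub (subset_closure hξ))
  have e : (xiHat ε ξ Δ.1).2 = (2 : ℝ) • (xiHat ε ξ ((1 / 2 : ℝ) • Δ).1).2 - ξ.2 := by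
    ext k
    simp [xiHat]
    ring
  rw [e]
  refine (vnorm_sub_le _ _).trans ?_
  rw [vnorm_smul, abs_two]
  linarith

theorem dist_xiHat_le {ε : ℝ} (hε : 0 ≤ ε) (hε1 : ε ≤ 1) (ξ : Pair) (η : Eta) :
    dist (xiHat ε ξ η) ξ ≤ ε * etaNorm η := by
  have hN := etaNorm_nonneg η
  have hb : ∀ (j : Fin (ord 1)) (k : Fin 3), |η 1 (j, k)| ≤ etaNorm η := fun j k =>
    (abs_apply_le_vnorm (η 1) (j, k)).trans (vnorm_le_etaNorm η 1)
  refine max_le ((dist_pi_le_iff (by positivity)).2 fun k => ?_)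
    ((dist_pi_le_iff (by positivity)).2 fun k => ?_)
  · have h2 : ε ^ 2 ≤ ε := by nlinarith
    simp only [xiHat, Real.dist_eq, sub_sub_cancel_left, abs_neg, abs_mul, abs_pow, abs_of_nonneg hε]
    exact mul_le_mul h2 (hb _ _) (abs_nonneg _) hε
  · simp only [xiHat, Real.dist_eq, sub_sub_cancel_left, abs_neg, abs_mul, abs_of_nonneg hε]
    exact mul_le_mul_of_nonneg_left (hb _ _) hε

/-- At the second level of the minimum, coercivity gives `ε ‖η‖ ≤ r`, so the estimate stays within
the margin `r` of `ξ`. -/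
theorem le_cΔ (hn : 0 < n) {p : Params n} {Ωsub : Set Pair} {P : ObsMatrices} {c r : ℝ}
    (hc : 0 < c) (hP : ∀ η : Eta, c * etaNorm η ^ 2 ≤ obsForm P η) (hr : 0 < r)
    (hmargin : ∀ ξ ∈ Ωsub, ∀ ζ : Pair, dist ζ ξ ≤ r → ζ ∈ Ωξ p)
    {d₂ d₃ cω ε : ℝ} (hd₂ : 0 < d₂) (hd₃ : 0 < d₃) (hcω : 0 < cω) (hε : 0 < ε) (hε1 : ε ≤ 1) :
    min cω (r ^ 2 * c * d₃ / ε ^ 3) ≤ cΔ p Ωsub P d₂ d₃ cω ε := by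
  have hW : ∀ η : Eta, 0 ≤ obsForm P η := fun η =>
    (mul_nonneg hc.le (sq_nonneg _)).trans (hP η)
  -- The candidate levels are bounded by `cω`: a state with only one nonzero component of `ω̃`
  -- attains any given value of `V_Δ`. This needs at least one rotor.
  refine le_csSup ⟨cω, ?_⟩ ⟨lt_min hcω (by positivity), ?_⟩
  · rintro c' ⟨hc', hsub⟩
    set Δ : State n := (0, 0, Pi.single ⟨0, hn⟩ √c') with hΔ
    have hV : VΔ P d₂ d₃ ε Δ = c' := by
      simp [VΔ_eq, hΔ, obsForm, Vω, hc'.le]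
    have := (hsub (show Δ ∈ {Δ : State n | VΔ P d₂ d₃ ε Δ ≤ c'} from hV.le)).2
    have h2 : Vω d₂ Δ.2 ≤ cω := this
    simpa [Vω, hΔ, hc'.le] using h2
  · intro Δ hΔ
    have hV : VΔ P d₂ d₃ ε Δ ≤ min cω (r ^ 2 * c * d₃ / ε ^ 3) := hΔ
    rw [VΔ_eq] at hV
    have h1 := hV.trans (min_le_left _ _)
    have h2 := hV.trans (min_le_right _ _)
    have h3 : 0 ≤ d₃ * (ε⁻¹ * obsForm P Δ.1) := by have := hW Δ.1; positivity
    have h4 := Vω_nonneg hd₂.le Δ.2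
    refine ⟨fun ξ hξ => hmargin ξ hξ _ ((dist_xiHat_le hε.le hε1 ξ Δ.1).trans ?_), ?_⟩
    · have h5 : d₃ * (ε⁻¹ * (c * etaNorm Δ.1 ^ 2)) ≤ r ^ 2 * c * d₃ / ε ^ 3 := by
        have : d₃ * (ε⁻¹ * (c * etaNorm Δ.1 ^ 2)) ≤ d₃ * (ε⁻¹ * obsForm P Δ.1) := by
          have := hP Δ.1
          gcongr
        linarith
      rw [le_div_iff₀ (by positivity)] at h5
      have h6 : (ε * etaNorm Δ.1) ^ 2 * (c * d₃) ≤ r ^ 2 * (c * d₃) := by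
        have e : d₃ * (ε⁻¹ * (c * etaNorm Δ.1 ^ 2)) * ε ^ 3 = (ε * etaNorm Δ.1) ^ 2 * (c * d₃) := by
          field_simp
        rw [← e]; linarith
      exact le_of_sq_le_sq (le_of_mul_le_mul_right h6 (by positivity)) hr.le
    · change Vω d₂ Δ.2 ≤ cω
      linarith

/-! ### Derivatives of the Lyapunov functions along curves -/

section Derivatives

variable {I : Set ℝ} {t : ℝ}

theorem hasDerivWithinAt_dotProduct {ι : Type*} [Fintype ι] {u v : ℝ → ι → ℝ} {u' v' : ι → ℝ}
    (hu : HasDerivWithinAt u u' I t) (hv : HasDerivWithinAt v v' I t) :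
    HasDerivWithinAt (fun t => u t ⬝ᵥ v t) (u' ⬝ᵥ v t + u t ⬝ᵥ v') I t := by
  simp only [dotProduct, ← Finset.sum_add_distrib]
  exact HasDerivWithinAt.fun_sum fun i _ =>
    (hasDerivWithinAt_pi.1 hu i).mul (hasDerivWithinAt_pi.1 hv i)

theorem hasDerivWithinAt_mulVec {ι κ : Type*} [Fintype ι] [Fintype κ] (A : Matrix ι κ ℝ)
    {u : ℝ → κ → ℝ} {u' : κ → ℝ} (hu : HasDerivWithinAt u u' I t) :
    HasDerivWithinAt (fun t => A *ᵥ u t) (A *ᵥ u') I t := by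
  refine hasDerivWithinAt_pi.2 fun i => ?_
  have := hasDerivWithinAt_dotProduct (hasDerivWithinAt_const t I (A.row i)) hu
  rw [zero_dotProduct, zero_add] at this
  exact this

theorem hasDerivWithinAt_obsForm (P : ObsMatrices) {η : ℝ → Eta} {η' : Eta}
    (h : HasDerivWithinAt η η' I t) :
    HasDerivWithinAt (fun t => obsForm P (η t)) (obsFormDeriv P (η t) η') I t := by
  refine HasDerivWithinAt.fun_sum fun i _ => ?_
  have hi := hasDerivWithinAt_pi.1 h i
  exact hasDerivWithinAt_dotProduct hi (hasDerivWithinAt_mulVec (P i) hi)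

theorem hasDerivWithinAt_Vω (d₂ : ℝ) {w : ℝ → (Fin n → ℝ) × (Fin n → ℝ)}
    {w' : (Fin n → ℝ) × (Fin n → ℝ)} (h : HasDerivWithinAt w w' I t) :
    HasDerivWithinAt (fun t => Vω d₂ (w t)) (VωDeriv d₂ (w t) w') I t := by
  have h1 : HasDerivWithinAt (fun t => (w t).1) w'.1 I t := h.fst
  have h2 : HasDerivWithinAt (fun t => (w t).2) w'.2 I t := h.snd
  have := ((hasDerivWithinAt_dotProduct h1 h1).const_mul d₂).add (hasDerivWithinAt_dotProduct h2 h2)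
  refine this.congr_deriv ?_
  rw [VωDeriv, dotProduct_comm w'.1, dotProduct_comm w'.2]
  ring

theorem hasDerivWithinAt_VΔ (P : ObsMatrices) (d₂ d₃ ε : ℝ) {x : ℝ → State n} {x' : State n}
    (h : HasDerivWithinAt x x' I t) :
    HasDerivWithinAt (fun t => VΔ P d₂ d₃ ε (x t))
      (d₃ * (ε⁻¹ * obsFormDeriv P (x t).1 x'.1) + VωDeriv d₂ (x t).2 x'.2) I t :=
  (((hasDerivWithinAt_obsForm P h.fst).const_mul ε⁻¹).const_mul d₃).add
    (hasDerivWithinAt_Vω d₂ h.snd)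

theorem hasDerivWithinAt_Ici_of_Icc {E : Type*} [NormedAddCommGroup E] [NormedSpace ℝ E]
    {x : ℝ → E} {x' : E} {T : ℝ} (ht : t ∈ Set.Ico 0 T)
    (h : HasDerivWithinAt x x' (Set.Icc 0 T) t) : HasDerivWithinAt x x' (Set.Ici t) t :=
  h.mono_of_mem_nhdsWithin (Filter.mem_of_superset (Icc_mem_nhdsGE ht.2)
    (Set.Icc_subset_Icc_left ht.1))

end Derivatives

/-! ### Positive invariance -/

/-- The derivative of `V_Δ` is negative on the boundary of `Ω_Δ`. -/
theorem VΔ_deriv_neg {P : ObsMatrices} {d₂ d₃ ε τ C₁ C₂ Λ κ : ℝ} (hε : 0 < ε)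
    (hd₃ : 0 < d₃) (hτ : 0 < τ) {Δ x' : State n}
    (hdis : ε * obsFormDeriv P Δ.1 x'.1 ≤
      -(1 / 2) * etaNorm Δ.1 ^ 2 + C₁ * (Δ.2.1 ⬝ᵥ Δ.2.1) + C₂ * (ε ^ 2 * κ ^ 2))
    (hact : VωDeriv d₂ Δ.2 x'.2 ≤ -(τ⁻¹ * (2 * d₂ * (Δ.2.1 ⬝ᵥ Δ.2.1) + Δ.2.2 ⬝ᵥ Δ.2.2)))
    (hW : obsForm P Δ.1 ≤ Λ * etaNorm Δ.1 ^ 2) (hεΛ : 2 * Λ * ε ≤ τ)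
    (hd : d₃ * (C₁ * τ) ≤ d₂ * ε ^ 2) (hV : τ * (C₂ * d₃ * κ ^ 2) < VΔ P d₂ d₃ ε Δ) :
    d₃ * (ε⁻¹ * obsFormDeriv P Δ.1 x'.1) + VωDeriv d₂ Δ.2 x'.2 < 0 := by
  have hws := dotProduct_self_nonneg' Δ.2.1
  rw [VΔ_eq, Vω] at hV
  generalize Δ.2.1 ⬝ᵥ Δ.2.1 = a at *
  generalize Δ.2.2 ⬝ᵥ Δ.2.2 = b at *
  generalize obsForm P Δ.1 = W at *
  have hN := sq_nonneg (etaNorm Δ.1)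
  generalize etaNorm Δ.1 ^ 2 = N at *
  -- In terms of `q = d₃ / ε²` the forcing by `ω̃_s` is absorbed when `q C₁ τ ≤ d₂`, which uses up
  -- half of the term `2 d₂ ‖ω̃_s‖²`. In total, `τ` times the derivative is at most `-V_Δ + τ C₂ d₃
  -- κ²`.
  obtain ⟨q, hq⟩ : ∃ q, q = d₃ / ε ^ 2 := ⟨_, rfl⟩
  have hq0 : 0 < q := by rw [hq]; positivity
  have hd₃q : d₃ = q * ε ^ 2 := by rw [hq]; field_simp
  have e1 : d₃ * (ε⁻¹ * obsFormDeriv P Δ.1 x'.1) = q * (ε * obsFormDeriv P Δ.1 x'.1) := by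
    rw [hd₃q]; field_simp
  have e2 : d₃ * (ε⁻¹ * W) = q * (ε * W) := by rw [hd₃q]; field_simp
  rw [e1]
  rw [e2] at hV
  have h1 := mul_le_mul_of_nonneg_left hdis hq0.le
  have h2 : q * (C₁ * τ) ≤ d₂ := by
    rw [hd₃q] at hd
    have : (q * (C₁ * τ)) * ε ^ 2 ≤ d₂ * ε ^ 2 := by linarith
    exact le_of_mul_le_mul_right this (by positivity)
  have h3 : τ * (q * (ε * obsFormDeriv P Δ.1 x'.1)) ≤
      -(q * (ε * W)) + d₂ * a + τ * (C₂ * d₃ * κ ^ 2) := by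
    have k1 := mul_le_mul_of_nonneg_left h1 hτ.le
    have k2 := mul_le_mul_of_nonneg_right h2 hws
    have k3 : q * (ε * W) ≤ q * (τ * (1 / 2 * N)) := by
      refine mul_le_mul_of_nonneg_left ?_ hq0.le
      have := mul_le_mul_of_nonneg_left hW hε.le
      have := mul_le_mul_of_nonneg_right hεΛ hN
      linarith
    rw [hd₃q]
    linarith
  have h4 : τ * VωDeriv d₂ Δ.2 x'.2 ≤ -(2 * d₂ * a + b) := by
    have := mul_le_mul_of_nonneg_left hact hτ.le
    rwa [mul_neg, ← mul_assoc, mul_inv_cancel₀ hτ.ne', one_mul] at this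
  have h5 : τ * (q * (ε * obsFormDeriv P Δ.1 x'.1) + VωDeriv d₂ Δ.2 x'.2) < τ * 0 := by linarith
  exact lt_of_mul_lt_mul_left h5 hτ.le

/-- A sublevel set of `V_Δ` is invariant for curves along which `V_Δ` decreases on its boundary. -/
theorem VΔ_le_of_deriv_neg {P : ObsMatrices} {d₂ d₃ ε c T : ℝ} {x x' : ℝ → State n}
    (hx : ∀ t ∈ Set.Icc 0 T, HasDerivWithinAt x (x' t) (Set.Icc 0 T) t)
    (hneg : ∀ t ∈ Set.Ico 0 T, VΔ P d₂ d₃ ε (x t) = c →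
      d₃ * (ε⁻¹ * obsFormDeriv P (x t).1 (x' t).1) + VωDeriv d₂ (x t).2 (x' t).2 < 0)
    (h0 : VΔ P d₂ d₃ ε (x 0) ≤ c) : ∀ t ∈ Set.Icc 0 T, VΔ P d₂ d₃ ε (x t) ≤ c := by
  have hd := fun t ht => hasDerivWithinAt_VΔ P d₂ d₃ ε (hx t ht)
  exact image_le_of_deriv_right_lt_deriv_boundary
    (fun t ht => (hd t ht).continuousWithinAt)
    (fun t ht => hasDerivWithinAt_Ici_of_Icc ht (hd t (Set.Ico_subset_Icc_self ht)))
    h0 (fun t => hasDerivAt_const t c) hneg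

/-! ### Exponential convergence -/

theorem le_exp_mul_of_deriv_le {U U' : ℝ → ℝ} {c T : ℝ}
    (hU : ∀ t ∈ Set.Icc 0 T, HasDerivWithinAt U (U' t) (Set.Icc 0 T) t)
    (hle : ∀ t ∈ Set.Icc 0 T, U' t ≤ -(c * U t)) :
    ∀ t ∈ Set.Icc 0 T, U t ≤ Real.exp (-(c * t)) * U 0 := by
  have hexp : ∀ t, HasDerivAt (fun t => Real.exp (c * t)) (Real.exp (c * t) * (c * 1)) t :=
    fun t => ((hasDerivAt_id t).const_mul c).exp
  have hd : ∀ t ∈ Set.Icc 0 T, HasDerivWithinAt (fun t => Real.exp (c * t) * U t)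
      (Real.exp (c * t) * (c * 1) * U t + Real.exp (c * t) * U' t) (Set.Icc 0 T) t :=
    fun t ht => (hexp t).hasDerivWithinAt.mul (hU t ht)
  intro t ht
  have h := image_le_of_deriv_right_le_deriv_boundary (B := fun _ => U 0) (B' := fun _ => 0)
    (fun t ht => (hd t ht).continuousWithinAt)
    (fun t ht => hasDerivWithinAt_Ici_of_Icc ht (hd t (Set.Ico_subset_Icc_self ht)))
    (by simp) continuousOn_const (fun t _ => hasDerivWithinAt_const t _ _)
    (fun t ht => by
      have := mul_le_mul_of_nonneg_left (hle t (Set.Ico_subset_Icc_self ht))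
        (Real.exp_pos (c * t)).le
      linarith) ht
  have h2 := mul_le_mul_of_nonneg_left h (Real.exp_pos (-(c * t))).le
  rwa [← mul_assoc, ← Real.exp_add, neg_add_cancel, Real.exp_zero, one_mul] at h2

/-- A fast scalar variable driven by a slowly decaying input. -/
theorem le_of_fast_deriv_le {W W' : ℝ → ℝ} {T τ ε Λ A B D : ℝ} (hε : 0 < ε) (hτ : 0 < τ)
    (hΛ : 0 < Λ) (hεΛ : 4 * Λ * ε ≤ τ) (hD : 0 < D) (hA : 0 ≤ A) (hB : 4 * Λ * A ≤ B)
    (hW : ∀ t ∈ Set.Icc 0 T, HasDerivWithinAt W (W' t) (Set.Icc 0 T) t)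
    (hle : ∀ t ∈ Set.Icc 0 T,
      ε * W' t ≤ -(W t / (2 * Λ)) + A * Real.exp (-(τ⁻¹ * t)) + D)
    (h0 : W 0 ≤ B) :
    ∀ t ∈ Set.Icc 0 T, W t ≤ B * Real.exp (-(τ⁻¹ * t)) + 3 * Λ * D := by
  have hexp : ∀ t, HasDerivAt (fun t => B * Real.exp (-(τ⁻¹ * t)) + 3 * Λ * D)
      (B * (Real.exp (-(τ⁻¹ * t)) * (-(τ⁻¹ * 1)))) t := fun t =>
    ((((hasDerivAt_id t).const_mul τ⁻¹).neg.exp).const_mul B).add_const _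
  refine image_le_of_deriv_right_lt_deriv_boundary
    (fun t ht => (hW t ht).continuousWithinAt)
    (fun t ht => hasDerivWithinAt_Ici_of_Icc ht (hW t (Set.Ico_subset_Icc_self ht)))
    ?_ hexp (fun t ht heq => ?_)
  · simp only [mul_zero, neg_zero, Real.exp_zero]
    nlinarith [mul_pos hΛ hD]
  -- At a contact point, with `y = B e / (4Λ)`, the right side is at most `-2y + y - D/2`, while `ε`
  -- times the slope of the barrier is at least `-y`. Any factor above 2 in place of 3 would leave a
  -- strict gap.
  · have h := hle t (Set.Ico_subset_Icc_self ht)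
    have he := (Real.exp_pos (-(τ⁻¹ * t))).le
    generalize Real.exp (-(τ⁻¹ * t)) = e at *
    rw [heq] at h
    have hB0 : 0 ≤ B := le_trans (by positivity) hB
    have h1 : ε * τ⁻¹ * (4 * Λ) ≤ 1 := by
      rw [← mul_le_mul_iff_left₀ hτ]
      have : ε * τ⁻¹ * (4 * Λ) * τ = 4 * Λ * ε := by field_simp
      linarith
    have h2 := mul_le_mul_of_nonneg_right h1 (mul_nonneg hB0 he)
    have h3 := mul_le_mul_of_nonneg_right hB he
    have e1 : (B * e + 3 * Λ * D) / (2 * Λ) = B * e / (2 * Λ) + 3 / 2 * D := by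
      field_simp
    obtain ⟨y, hy⟩ : ∃ y, y = B * e / (4 * Λ) := ⟨_, rfl⟩
    have e2 : B * e / (2 * Λ) = 2 * y := by rw [hy]; field_simp; ring
    have e3 : B * e = 4 * Λ * y := by rw [hy]; field_simp
    rw [e1, e2] at h
    rw [e3] at h2 h3
    have h4 : A * e ≤ y := by
      have : 4 * Λ * (A * e) ≤ 4 * Λ * y := by linarith
      exact le_of_mul_le_mul_left this (by positivity)
    have h5 : ε * τ⁻¹ * (B * e) ≤ y := by
      have : 4 * Λ * (ε * τ⁻¹ * (B * e)) ≤ 4 * Λ * y := by rw [e3]; linarith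
      exact le_of_mul_le_mul_left this (by positivity)
    have h6 : ε * W' t < ε * (B * (e * (-(τ⁻¹ * 1)))) := by linarith
    exact lt_of_mul_lt_mul_left h6 hε.le

theorem weighted_sq_add_le {a b x y : ℝ} (ha : 0 ≤ a) (hb : 0 ≤ b) (hx : 0 ≤ x) (hy : 0 ≤ y) :
    a * x ^ 2 + b * y ^ 2 ≤ ((a + b + 1) * x + (a + b + 1) * y) ^ 2 := by
  have h1 : a ≤ (a + b + 1) ^ 2 := by nlinarith [mul_nonneg ha hb]
  have h2 : b ≤ (a + b + 1) ^ 2 := by nlinarith [mul_nonneg ha hb]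
  have h3 := mul_le_mul_of_nonneg_right h1 (sq_nonneg x)
  have h4 := mul_le_mul_of_nonneg_right h2 (sq_nonneg y)
  have h5 : 0 ≤ (a + b + 1) ^ 2 * (x * y) := by positivity
  linarith

/-- Exponential convergence of the error state, with constants that do not depend on the weights
of the Lyapunov function. -/
theorem exists_exponential_bound (p : Params n) (P : ObsMatrices) {C₁ C₂ Λ c : ℝ} (hC₁ : 0 < C₁)
    (hC₂ : 0 < C₂) (hΛ : 0 < Λ) (hc : 0 < c)
    (hPc : ∀ η : Eta, c * etaNorm η ^ 2 ≤ obsForm P η)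
    (hPΛ : ∀ η : Eta, obsForm P η ≤ Λ * etaNorm η ^ 2) :
    ∃ C > 0, ∀ ε, 0 < ε → 4 * Λ * ε ≤ p.τm → ∀ κ, 0 < κ → ∀ (Ωsub : Set Pair) (φ : Disturbance)
      (s : Signals n), s.Admissible p Ωsub → ∀ T, ∀ Δ : ℝ → State n,
      IsSolution p φ s ε (Set.Icc 0 T) Δ →
      (∀ t ∈ Set.Icc 0 T, ε * obsFormDeriv P (Δ t).1 (rhs p φ s ε t (Δ t)).1 ≤
        -(1 / 2) * etaNorm (Δ t).1 ^ 2 + C₁ * ((Δ t).2.1 ⬝ᵥ (Δ t).2.1) + C₂ * (ε ^ 2 * κ ^ 2)) →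
      ∀ t ∈ Set.Icc 0 T, stateNorm (Δ t) ≤
        C * Real.exp (-(2 * p.τm)⁻¹ * t) * stateNorm (Δ 0) + C * (ε * κ) := by
  have hτ := p.hτm
  have hω := p.hωmax
  -- An auxiliary weight, the largest that `VωDeriv_rhs_le` allows, replaces `d₂` so that the final
  -- constants do not depend on `d₂`.
  obtain ⟨b, hb⟩ : ∃ b, b = 1 / (2 * p.ωmax ^ 2) := ⟨_, rfl⟩
  have hb0 : 0 < b := by rw [hb]; positivity
  have hb1 : 2 * b * p.ωmax ^ 2 ≤ 1 := by rw [hb]; field_simp; rfl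
  set A := C₁ * ((b + 1) / b) with hA
  have hA0 : 0 < A := by positivity
  -- The summand `Λ` covers the initial value of the observer form, and `4 Λ A` the actuator
  -- forcing.
  set K := Λ + 4 * Λ * A with hK
  have hK0 : 0 < K := by positivity
  set A₁ := K / c + (b + 1) / b + (b + 1) with hA₁
  have hA₁0 : 0 < A₁ := by positivity
  set A₂ := 3 * Λ * C₂ / c with hA₂
  have hA₂0 : 0 < A₂ := by positivity
  refine ⟨A₁ + A₂ + 1, by positivity, fun ε hε hεΛ κ hκ Ωsub φ s hs T Δ hΔ hdis => ?_⟩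
  set σ := stateNorm (Δ 0) ^ 2 with hσ
  have hσ0 : 0 ≤ σ := sq_nonneg _
  have hσe : σ = etaNorm (Δ 0).1 ^ 2 + (Δ 0).2.1 ⬝ᵥ (Δ 0).2.1 + (Δ 0).2.2 ⬝ᵥ (Δ 0).2.2 :=
    stateNorm_sq _
  have i1 := sq_nonneg (etaNorm (Δ 0).1)
  have i2 := dotProduct_self_nonneg' (Δ 0).2.1
  have i3 := dotProduct_self_nonneg' (Δ 0).2.2
  have hU0 : Vω b (Δ 0).2 ≤ (b + 1) * σ := by
    rw [Vω, hσe]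
    nlinarith
  have hU : ∀ t ∈ Set.Icc 0 T, Vω b (Δ t).2 ≤ Real.exp (-(p.τm⁻¹ * t)) * ((b + 1) * σ) := by
    intro t ht
    refine (le_exp_mul_of_deriv_le (fun t ht => hasDerivWithinAt_Vω b (hΔ t ht).snd)
      (fun t ht => ?_) t ht).trans (mul_le_mul_of_nonneg_left hU0 (Real.exp_pos _).le)
    refine (VωDeriv_rhs_le p hs φ ε ht.1 hb0.le hb1 (Δ t)).trans (neg_le_neg ?_)
    refine mul_le_mul_of_nonneg_left ?_ (inv_pos.2 hτ).le
    have := mul_nonneg hb0.le (dotProduct_self_nonneg' (Δ t).2.1)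
    rw [Vω]
    linarith
  have hs1 : ∀ t ∈ Set.Icc 0 T,
      (Δ t).2.1 ⬝ᵥ (Δ t).2.1 ≤ (b + 1) / b * (Real.exp (-(p.τm⁻¹ * t)) * σ) := by
    intro t ht
    have h := hU t ht
    have := dotProduct_self_nonneg' (Δ t).2.2
    rw [Vω] at h
    rw [div_mul_eq_mul_div, le_div_iff₀ hb0]
    linarith
  have hs2 : ∀ t ∈ Set.Icc 0 T,
      (Δ t).2.2 ⬝ᵥ (Δ t).2.2 ≤ (b + 1) * (Real.exp (-(p.τm⁻¹ * t)) * σ) := by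
    intro t ht
    have h := hU t ht
    have := mul_nonneg hb0.le (dotProduct_self_nonneg' (Δ t).2.1)
    rw [Vω] at h
    linarith
  have hW := le_of_fast_deriv_le (W := fun t => obsForm P (Δ t).1) (A := A * σ) (B := K * σ)
    (D := C₂ * (ε ^ 2 * κ ^ 2)) hε hτ hΛ hεΛ (by positivity) (by positivity)
    (by nlinarith [mul_nonneg hΛ.le hσ0]) (fun t ht => hasDerivWithinAt_obsForm P (hΔ t ht).fst)
    (fun t ht => by
      have h1 := hdis t ht
      have h2 := mul_le_mul_of_nonneg_left (hs1 t ht) hC₁.le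
      have h3 : obsForm P (Δ t).1 / (2 * Λ) ≤ 1 / 2 * etaNorm (Δ t).1 ^ 2 := by
        rw [div_le_iff₀ (by positivity)]
        linarith [hPΛ (Δ t).1]
      linarith)
    (by
      have h1 := hPΛ (Δ 0).1
      have h2 : Λ * etaNorm (Δ 0).1 ^ 2 ≤ Λ * σ := mul_le_mul_of_nonneg_left (by linarith) hΛ.le
      have : 0 ≤ 4 * Λ * A * σ := by positivity
      linarith)
  intro t ht
  -- Squared norms decay at rate `1/τm`, hence norms at rate `1/(2 τm)`.
  obtain ⟨e, he⟩ : ∃ e, e = Real.exp (-(2 * p.τm)⁻¹ * t) := ⟨_, rfl⟩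
  have he0 : 0 < e := by rw [he]; exact Real.exp_pos _
  have hee : Real.exp (-(p.τm⁻¹ * t)) = e ^ 2 := by
    rw [he, ← Real.exp_nat_mul]
    congr 1
    field_simp
    ring
  have hN : etaNorm (Δ t).1 ^ 2 ≤ K / c * (e ^ 2 * σ) + A₂ * (ε * κ) ^ 2 := by
    have h1 := (hPc (Δ t).1).trans (hW t ht)
    rw [hee] at h1
    have : K / c * (e ^ 2 * σ) + A₂ * (ε * κ) ^ 2 =
        (K * σ * e ^ 2 + 3 * Λ * (C₂ * (ε ^ 2 * κ ^ 2))) / c := by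
      rw [hA₂]; ring
    rw [this, le_div_iff₀ hc]
    linarith
  have h1 := hs1 t ht
  have h2 := hs2 t ht
  rw [hee] at h1 h2
  rw [← he]
  have hs0 := stateNorm_nonneg (Δ 0)
  refine le_of_sq_le_sq ?_ (by positivity)
  rw [stateNorm_sq]
  have hfin : A₁ * (e * stateNorm (Δ 0)) ^ 2 + A₂ * (ε * κ) ^ 2 ≤
      ((A₁ + A₂ + 1) * e * stateNorm (Δ 0) + (A₁ + A₂ + 1) * (ε * κ)) ^ 2 := by
    rw [mul_assoc]
    exact weighted_sq_add_le hA₁0.le hA₂0.le (by positivity) (by positivity)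
  refine le_trans ?_ hfin
  rw [mul_pow, ← hσ]
  linarith

end EHGO

/-! ### Global existence for ordinary differential equations. -/

/-- A bounded, globally Lipschitz vector field has a solution on `[0, ∞)`. -/
theorem exists_global_solution_of_lipschitz_of_bounded {E : Type*} [NormedAddCommGroup E]
    [NormedSpace ℝ E] [CompleteSpace E] {w : ℝ → E → E} {K M : NNReal}
    (hlip : ∀ t, 0 ≤ t → LipschitzWith K (w t)) (hcont : ∀ x, ContinuousOn (w · x) (Set.Ici 0))
    (hM : ∀ t, 0 ≤ t → ∀ x, ‖w t x‖ ≤ M) (x₀ : E) :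
    ∃ x : ℝ → E, x 0 = x₀ ∧ ∀ t ∈ Set.Ici (0 : ℝ), HasDerivWithinAt x (w t (x t)) (Set.Ici 0) t := by
  have hloc : ∀ k : ℕ, ∃ α : ℝ → E, α 0 = x₀ ∧
      ∀ t ∈ Set.Icc (0 : ℝ) (k + 1), HasDerivWithinAt α (w t (α t)) (Set.Icc (0 : ℝ) (k + 1)) t := by
    intro k
    have hk : (0 : ℝ) ≤ k + 1 := by positivity
    -- A field bounded by `M` moves a point by at most `M (k + 1)` on this interval, so
    -- Picard–Lindelöf applies on its whole length.
    have hpl : IsPicardLindelof w (⟨0, Set.left_mem_Icc.2 hk⟩ : Set.Icc (0 : ℝ) (k + 1)) x₀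
        (M * (k + 1)) 0 M K :=
      { lipschitzOnWith := fun t ht => (hlip t ht.1).lipschitzOnWith
        continuousOn := fun x _ => (hcont x).mono fun t ht => ht.1
        norm_le := fun t ht x _ => hM t ht.1 x
        mul_max_le := by simp [hk] }
    exact hpl.exists_eq_forall_mem_Icc_hasDerivWithinAt₀
  choose α hα0 hα using hloc
  have huniq : ∀ j k : ℕ, j ≤ k → Set.EqOn (α j) (α k) (Set.Icc (0 : ℝ) (j + 1)) := by
    intro j k hjk
    have hjk' : (j : ℝ) ≤ k := by exact_mod_cast hjk
    have hsub : Set.Icc (0 : ℝ) (j + 1) ⊆ Set.Icc (0 : ℝ) (k + 1) :=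
      Set.Icc_subset_Icc_right (by linarith)
    have hk := fun t ht => (hα k t (hsub ht)).mono hsub
    exact ODE_solution_unique_of_mem_Icc_right (v := w) (s := fun _ => Set.univ) (K := K)
      (fun t ht => (hlip t ht.1).lipschitzOnWith)
      (fun t ht => (hα j t ht).continuousWithinAt)
      (fun t ht => EHGO.hasDerivWithinAt_Ici_of_Icc ht (hα j t (Set.Ico_subset_Icc_self ht)))
      (fun _ _ => trivial) (fun t ht => (hk t ht).continuousWithinAt)
      (fun t ht => EHGO.hasDerivWithinAt_Ici_of_Icc ht (hk t (Set.Ico_subset_Icc_self ht)))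
      (fun _ _ => trivial) (by rw [hα0, hα0])
  -- Intervals of length `k + 1` make `t < ⌊t⌋₊ + 1` strict, so one local solution covers a
  -- neighbourhood of `t` in `[0, ∞)`; uniqueness identifies the pieces.
  refine ⟨fun t => α ⌊t⌋₊ t, by simp [hα0], fun t ht => ?_⟩
  have ht0 : (0 : ℝ) ≤ t := ht
  have hlt : t < (⌊t⌋₊ : ℝ) + 1 := Nat.lt_floor_add_one t
  have hmem : Set.Iio ((⌊t⌋₊ : ℝ) + 1) ∈ 𝓝[Set.Ici 0] t :=
    mem_nhdsWithin_of_mem_nhds (Iio_mem_nhds hlt)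
  have hd : HasDerivWithinAt (α ⌊t⌋₊) (w t (α ⌊t⌋₊ t)) (Set.Ici 0) t := by
    refine (hα ⌊t⌋₊ t ⟨ht0, hlt.le⟩).mono_of_mem_nhdsWithin ?_
    filter_upwards [hmem, self_mem_nhdsWithin] with u hu hu0
    exact ⟨hu0, le_of_lt hu⟩
  refine hd.congr_of_eventuallyEq ?_ rfl
  filter_upwards [hmem, self_mem_nhdsWithin] with u hu hu0
  have hu0' : (0 : ℝ) ≤ u := hu0
  have hle : ⌊u⌋₊ ≤ ⌊t⌋₊ := by
    have : ⌊u⌋₊ < ⌊t⌋₊ + 1 := (Nat.floor_lt hu0').2 (by push_cast; exact hu)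
    omega
  exact huniq _ _ hle ⟨hu0', (Nat.lt_floor_add_one u).le⟩

namespace EHGO

variable {n : ℕ}

/-! ### Truncation of the error state -/

/-- Truncation of a real number to `[-R, R]`. -/
def clamp (R a : ℝ) : ℝ := max (-R) (min R a)

theorem abs_clamp_le {R : ℝ} (hR : 0 ≤ R) (a : ℝ) : |clamp R a| ≤ R :=
  abs_le.2 ⟨le_max_left _ _, max_le (by linarith) (min_le_left _ _)⟩

theorem clamp_of_abs_le {R a : ℝ} (h : |a| ≤ R) : clamp R a = a := by
  rw [clamp, min_eq_right (abs_le.1 h).2, max_eq_right (abs_le.1 h).1]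

theorem abs_clamp_sub_le (R a b : ℝ) : |clamp R a - clamp R b| ≤ |a - b| := by
  unfold clamp
  have h1 := abs_max_sub_max_le_max (-R) (min R a) (-R) (min R b)
  have h2 := abs_min_sub_min_le_max R a R b
  simp only [sub_self, abs_zero] at h1 h2
  exact h1.trans (max_le (abs_nonneg _) (h2.trans (max_le (abs_nonneg _) le_rfl)))

/-- Componentwise truncation of the error state. -/
def clampState (R : ℝ) (Δ : State n) : State n :=
  (fun i j => clamp R (Δ.1 i j), fun k => clamp R (Δ.2.1 k), fun k => clamp R (Δ.2.2 k))

theorem state_norm_le_iff {c : ℝ} (hc : 0 ≤ c) (Δ : State n) :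
    ‖Δ‖ ≤ c ↔ (∀ i j, |Δ.1 i j| ≤ c) ∧ (∀ k, |Δ.2.1 k| ≤ c) ∧ ∀ k, |Δ.2.2 k| ≤ c := by
  simp only [Prod.norm_def, max_le_iff, pi_norm_le_iff_of_nonneg hc, Real.norm_eq_abs]

theorem norm_clampState_le {R : ℝ} (hR : 0 ≤ R) (Δ : State n) : ‖clampState R Δ‖ ≤ R :=
  (state_norm_le_iff hR _).2
    ⟨fun _ _ => abs_clamp_le hR _, fun _ => abs_clamp_le hR _, fun _ => abs_clamp_le hR _⟩

theorem clampState_of_norm_le {R : ℝ} {Δ : State n} (h : ‖Δ‖ ≤ R) : clampState R Δ = Δ := by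
  obtain ⟨h1, h2, h3⟩ := (state_norm_le_iff ((norm_nonneg Δ).trans h) Δ).1 h
  refine Prod.ext (funext fun i => funext fun j => clamp_of_abs_le (h1 i j))
    (Prod.ext (funext fun k => clamp_of_abs_le (h2 k)) (funext fun k => clamp_of_abs_le (h3 k)))

theorem norm_clampState_sub_le (R : ℝ) (Δ Γ : State n) :
    ‖clampState R Δ - clampState R Γ‖ ≤ ‖Δ - Γ‖ := by
  obtain ⟨h1, h2, h3⟩ := (state_norm_le_iff (norm_nonneg _) (Δ - Γ)).1 le_rfl
  exact (state_norm_le_iff (norm_nonneg _) _).2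
    ⟨fun i j => (abs_clamp_sub_le R _ _).trans (h1 i j),
      fun k => (abs_clamp_sub_le R _ _).trans (h2 k), fun k => (abs_clamp_sub_le R _ _).trans (h3 k)⟩

theorem norm_le_stateNorm (Δ : State n) : ‖Δ‖ ≤ stateNorm Δ := by
  have h := stateNorm_sq Δ
  have h1 := sq_nonneg (etaNorm Δ.1)
  have h2 := dotProduct_self_nonneg' Δ.2.1
  have h3 := dotProduct_self_nonneg' Δ.2.2
  have h0 := stateNorm_nonneg Δ
  refine (state_norm_le_iff h0 Δ).2 ⟨fun i j => ?_, fun k => ?_, fun k => ?_⟩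
  · refine (abs_apply_le_vnorm (Δ.1 i) j).trans ((vnorm_le_etaNorm Δ.1 i).trans ?_)
    exact le_of_sq_le_sq (by linarith) h0
  · refine (abs_apply_le_vnorm Δ.2.1 k).trans (le_of_sq_le_sq ?_ h0)
    rw [vnorm_sq]; linarith
  · refine (abs_apply_le_vnorm Δ.2.2 k).trans (le_of_sq_le_sq ?_ h0)
    rw [vnorm_sq]; linarith

/-! ### Regularity of the error dynamics -/

theorem continuousOn_rhs {p : Params n} {Ωsub : Set Pair} (hΩsub : closure Ωsub ⊆ Ωξ p)
    {φ : Disturbance} {κ : ℝ} (hφ : BoundedBy p φ κ) {s : Signals n} (hs : s.Admissible p Ωsub)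
    (ε : ℝ) (Δ : State n) : ContinuousOn (fun t => rhs p φ s ε t Δ) (Set.Ici 0) := by
  obtain ⟨a, ha, hbox⟩ := exists_angleBox p
  have hξ := hs.cont_ξ
  have hξ₁ : ContinuousOn (fun t => (s.ξ t).1) (Set.Ici 0) := continuous_fst.comp_continuousOn hξ
  have hξ₂ : ContinuousOn (fun t => (s.ξ t).2) (Set.Ici 0) := continuous_snd.comp_continuousOn hξ
  have hϑ : ContinuousOn (fun t => s.ϑr t + (s.ξ t).1) (Set.Ici 0) := hs.cont_ϑr.add hξ₁
  have hc : ∀ t ∈ Set.Ici (0 : ℝ), Real.cos ((s.ϑr t + (s.ξ t).1) 1) ≠ 0 := fun t ht =>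
    cos_ne_zero_of_mem_angleBox ha
      (hbox _ (hs.bound_ϑr t ht) _ (hΩsub (subset_closure (hs.mem_ξ t ht))))
  have hxi : ContinuousOn (fun t => xiHat ε (s.ξ t) Δ.1) (Set.Ici 0) := by
    refine ContinuousOn.prodMk ?_ ?_ <;> refine continuousOn_pi.2 fun k => ?_
    · exact (continuousOn_pi.1 hξ₁ k).sub continuousOn_const
    · exact (continuousOn_pi.1 hξ₂ k).sub continuousOn_const
  have hxc : ContinuousOn (fun t => xc3Hat ε (s.xc₃ t) Δ.1) (Set.Ici 0) :=
    continuousOn_pi.2 fun k => (continuousOn_pi.1 hs.cont_xc₃ k).sub continuousOn_const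
  have hf : ∀ {ξ : ℝ → Pair} {x : ℝ → Fin 3 → ℝ}, ContinuousOn ξ (Set.Ici 0) →
      ContinuousOn x (Set.Ici 0) → ∀ i, ContinuousOn
        (fun t => fbar p (ξ t) (x t) (s.ϑr t + (s.ξ t).1) (s.ϑr' t) i) (Set.Ici 0) := by
    intro ξ x h1 h2 i
    fin_cases i
    · exact continuousOn_const.sub h2
    · exact continuousOn_f p h1 hϑ hs.cont_ϑr' hc
    · exact continuousOn_const
  have hφc : ContinuousOn (fun t => φ t (s.ρ t, s.ξ t) (s.xc t)) (Set.Ici 0) :=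
    hφ.1.comp_continuousOn (continuousOn_id.prodMk ((hs.cont_ρ.prodMk hξ).prodMk hs.cont_xc))
  refine ContinuousOn.prodMk (continuousOn_pi.2 fun i => ?_) (ContinuousOn.prodMk ?_ ?_)
  · have h1 := ((hf hξ hs.cont_xc₃ i).sub (hf hxi hxc i)).add
      (continuousOn_mulVec (continuousOn_Gbar p hϑ hc i) (continuousOn_const (c := Δ.2.1)))
    have h2 := continuousOn_mulVec (continuousOn_const (c := B₁ i)) h1
    have h3 := continuousOn_mulVec (continuousOn_const (c := B₂ i)) (continuousOn_pi.1 hφc i)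
    exact (((continuousOn_const (c := F p i *ᵥ Δ.1 i)).add h2).add (h3.const_smul ε)).const_smul ε⁻¹
  · refine continuousOn_pi.2 fun k => ?_
    simp only [Pi.smul_apply, Pi.add_apply, Matrix.mulVec_diagonal, smul_eq_mul]
    have := (continuousOn_pi.1 hs.cont_ωsd k).sqrt
    fun_prop
  · exact continuousOn_const

/-- On bounded sets of error states the error dynamics are Lipschitz, uniformly in time. -/
theorem exists_rhs_lipschitz (p : Params n) {Ωsub : Set Pair} (hΩsub : closure Ωsub ⊆ Ωξ p)
    (φ : Disturbance) {s : Signals n} (hs : s.Admissible p Ωsub)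
    (ε : ℝ) {R : ℝ} (hR : 0 ≤ R) :
    ∃ K, 0 ≤ K ∧ ∀ t, 0 ≤ t → ∀ Δ Γ : State n, ‖Δ‖ ≤ R → ‖Γ‖ ≤ R →
      ‖rhs p φ s ε t Δ - rhs p φ s ε t Γ‖ ≤ K * ‖Δ - Γ‖ := by
  obtain ⟨a, ha, hbox⟩ := exists_angleBox p
  obtain ⟨K, hK, hf⟩ := exists_fbar_lipschitz p ha
  obtain ⟨G, hG0, hG⟩ := exists_Gbar_bound p ha
  obtain ⟨_, _, Q, hQ, hQξ⟩ := exists_bound_Ωξ p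
  obtain ⟨c, hc, hcN⟩ := exists_etaNorm_le
  have hθ := p.haθ
  have hτ := inv_pos.2 p.hτm
  have hω := p.hωmax
  -- `S` bounds the rate estimates when the error state has norm at most `R`; the quadratic drift is
  -- Lipschitz only on such sets.
  obtain ⟨S, hSdef⟩ : ∃ S, S = Q + |ε| * (c * R) := ⟨_, rfl⟩
  have hS : 0 ≤ S := by rw [hSdef]; positivity
  obtain ⟨L, hL⟩ : ∃ L, L = 1 + K * (S + p.aθ) := ⟨_, rfl⟩
  have hL0 : 0 ≤ L := by rw [hL]; positivity
  obtain ⟨D, hD⟩ : ∃ D : Fin 3 → ℝ, ∀ i, D i = |ε⁻¹| * (frob (F p i) * c + frob (B₁ i) *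
    (L * (|ε| * c) + G * √(Fintype.card (Fin n)))) := ⟨_, fun _ => rfl⟩
  have hD0 : ∀ i, 0 ≤ D i := fun i => by
    have := frob_nonneg (F p i)
    have := frob_nonneg (B₁ i)
    rw [hD]; positivity
  refine ⟨∑ i, D i + p.τm⁻¹ * (2 + 2 * p.ωmax), ?_, fun t ht Δ Γ hΔ hΓ => ?_⟩
  · have := Finset.sum_nonneg fun i (_ : i ∈ Finset.univ) => hD0 i
    positivity
  have hξ := hΩsub (subset_closure (hs.mem_ξ t ht))
  have hϑ := hbox _ (hs.bound_ϑr t ht) _ hξ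
  set N := ‖Δ - Γ‖ with hN
  have hN0 : 0 ≤ N := norm_nonneg _
  obtain ⟨-, n1, n2⟩ := (state_norm_le_iff hN0 (Δ - Γ)).1 le_rfl
  have hηN : etaNorm (Δ.1 - Γ.1) ≤ c * N :=
    (hcN _).trans (mul_le_mul_of_nonneg_left (norm_fst_le (Δ - Γ)) hc)
  have hwN : vnorm (Δ.2.1 - Γ.2.1) ≤ √(Fintype.card (Fin n)) * N :=
    (vnorm_le_card_mul_norm _).trans (mul_le_mul_of_nonneg_left
      ((norm_fst_le (Δ - Γ).2).trans (norm_snd_le (Δ - Γ))) (Real.sqrt_nonneg _))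
  have hSb : ∀ Θ : State n, ‖Θ‖ ≤ R → vnorm (xiHat ε (s.ξ t) Θ.1).2 ≤ S := by
    intro Θ hΘ
    have h1 := vnorm_xiHat_sub ε (s.ξ t) Θ.1 0
    rw [xiHat_zero, sub_zero] at h1
    have h2 := (hcN Θ.1).trans (mul_le_mul_of_nonneg_left ((norm_fst_le Θ).trans hΘ) hc)
    have h3 := mul_le_mul_of_nonneg_left h2 (abs_nonneg ε)
    have h4 := vnorm_add_le ((xiHat ε (s.ξ t) Θ.1).2 - (s.ξ t).2) (s.ξ t).2
    rw [sub_add_cancel] at h4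
    have := (hQξ _ hξ).2
    rw [hSdef]
    linarith
  have hDle : ∀ i, D i ≤ ∑ i, D i := fun i =>
    Finset.single_le_sum (fun i _ => hD0 i) (Finset.mem_univ i)
  have hDs : 0 ≤ ∑ i, D i := Finset.sum_nonneg fun i _ => hD0 i
  have hT : 0 ≤ p.τm⁻¹ * (2 + 2 * p.ωmax) := by positivity
  refine (state_norm_le_iff (by positivity) _).2 ⟨fun i j => ?_, fun k => ?_, fun k => ?_⟩
  · refine (abs_apply_le_vnorm ((rhs p φ s ε t Δ - rhs p φ s ε t Γ).1 i) j).trans ?_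
    have e : (rhs p φ s ε t Δ - rhs p φ s ε t Γ).1 i = ε⁻¹ • (F p i *ᵥ (Δ.1 i - Γ.1 i)
        + B₁ i *ᵥ (-(fbar p (xiHat ε (s.ξ t) Δ.1) (xc3Hat ε (s.xc₃ t) Δ.1)
            (s.ϑr t + (s.ξ t).1) (s.ϑr' t) i
          - fbar p (xiHat ε (s.ξ t) Γ.1) (xc3Hat ε (s.xc₃ t) Γ.1)
            (s.ϑr t + (s.ξ t).1) (s.ϑr' t) i)
          + Gbar p (s.ϑr t + (s.ξ t).1) i *ᵥ (Δ.2.1 - Γ.2.1))) := by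
      simp only [rhs, Prod.fst_sub, Pi.sub_apply, Matrix.mulVec_sub, Matrix.mulVec_add,
        Matrix.mulVec_neg, ← smul_sub]
      congr 1
      abel
    rw [e, vnorm_smul]
    have h1 := hf S hS _ hϑ _ (hs.bound_ϑr' t ht) ε (s.ξ t) (s.xc₃ t) Δ.1 Γ.1 (hSb Δ hΔ)
      (hSb Γ hΓ) i
    rw [← hL] at h1
    have h2 := hG _ hϑ i (Δ.2.1 - Γ.2.1)
    have h3 : vnorm (-(fbar p (xiHat ε (s.ξ t) Δ.1) (xc3Hat ε (s.xc₃ t) Δ.1)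
            (s.ϑr t + (s.ξ t).1) (s.ϑr' t) i
          - fbar p (xiHat ε (s.ξ t) Γ.1) (xc3Hat ε (s.xc₃ t) Γ.1)
            (s.ϑr t + (s.ξ t).1) (s.ϑr' t) i)
          + Gbar p (s.ϑr t + (s.ξ t).1) i *ᵥ (Δ.2.1 - Γ.2.1)) ≤
        (L * (|ε| * c) + G * √(Fintype.card (Fin n))) * N := by
      refine (vnorm_add_le _ _).trans ?_
      rw [vnorm_neg]
      have k1 := mul_le_mul_of_nonneg_left (mul_le_mul_of_nonneg_left hηN (abs_nonneg ε)) hL0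
      have k2 := mul_le_mul_of_nonneg_left hwN hG0
      linarith
    have h4 : vnorm (F p i *ᵥ (Δ.1 i - Γ.1 i)) ≤ frob (F p i) * (c * N) :=
      (vnorm_mulVec_le _ _).trans (mul_le_mul_of_nonneg_left
        ((vnorm_le_etaNorm (Δ.1 - Γ.1) i).trans hηN) (frob_nonneg _))
    have h5 := (vnorm_mulVec_le (B₁ i) _).trans (mul_le_mul_of_nonneg_left h3 (frob_nonneg (B₁ i)))
    have h6 := mul_le_mul_of_nonneg_left ((vnorm_add_le _ _).trans (add_le_add h4 h5))
      (abs_nonneg ε⁻¹)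
    refine h6.trans ?_
    have h7 := mul_le_mul_of_nonneg_right (hDle i) hN0
    have h8 := mul_nonneg hT hN0
    have h9 := hD i
    calc _ = D i * N := by rw [h9]; ring
      _ ≤ _ := by linarith
  · have e : (rhs p φ s ε t Δ - rhs p φ s ε t Γ).2.1 k =
        p.τm⁻¹ * (-2 * (Δ - Γ).2.1 k + 2 * (√(s.ωsd t k) * (Δ - Γ).2.2 k)) := by
      simp only [rhs, Prod.snd_sub, Prod.fst_sub, Pi.sub_apply, Pi.smul_apply, Pi.add_apply,
        Matrix.mulVec_diagonal, smul_eq_mul]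
      ring
    rw [e, abs_mul, abs_of_pos hτ]
    have h1 : |√(s.ωsd t k) * (Δ - Γ).2.2 k| ≤ p.ωmax * N := by
      rw [abs_mul, abs_of_nonneg (Real.sqrt_nonneg _)]
      exact mul_le_mul (hs.bound_ωsd t ht k) (n2 k) (abs_nonneg _) hω.le
    have h2 : |-2 * (Δ - Γ).2.1 k + 2 * (√(s.ωsd t k) * (Δ - Γ).2.2 k)| ≤
        (2 + 2 * p.ωmax) * N := by
      refine (abs_add_le _ _).trans ?_
      rw [abs_mul, abs_mul, abs_neg, abs_two]
      linarith [n1 k]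
    have h3 := mul_le_mul_of_nonneg_left h2 hτ.le
    have h4 := mul_nonneg hDs hN0
    linarith
  · have e : (rhs p φ s ε t Δ - rhs p φ s ε t Γ).2.2 k = -(p.τm⁻¹ * (Δ - Γ).2.2 k) := by
      simp only [rhs, Prod.snd_sub, Pi.sub_apply, Pi.smul_apply, Pi.neg_apply, smul_eq_mul]
      ring
    rw [e, abs_neg, abs_mul, abs_of_pos hτ]
    have h3 := mul_le_mul_of_nonneg_left (n2 k) hτ.le
    have h4 := mul_nonneg hDs hN0
    have h5 : 0 ≤ p.τm⁻¹ * (1 + 2 * p.ωmax) * N := by positivity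
    linarith

/-- At the origin only the disturbance survives. Together with the Lipschitz estimate this bounds
the truncated vector field. -/
theorem exists_rhs_zero_bound (p : Params n) {Ωsub : Set Pair} (hΩsub : closure Ωsub ⊆ Ωξ p)
    {φ : Disturbance} {κ : ℝ} (hφ : BoundedBy p φ κ) {s : Signals n} (hs : s.Admissible p Ωsub)
    {ε : ℝ} (hε : ε ≠ 0) : ∃ M, 0 ≤ M ∧ ∀ t, 0 ≤ t → ‖rhs p φ s ε t 0‖ ≤ M := by
  have hκ : 0 ≤ κ := (vnorm_nonneg _).trans (hφ.vnorm_le hΩsub hs le_rfl 0)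
  have hB : ∀ i, 0 ≤ frob (B₂ i) * κ := fun i => mul_nonneg (frob_nonneg _) hκ
  have hM : 0 ≤ ∑ i, frob (B₂ i) * κ := Finset.sum_nonneg fun i _ => hB i
  refine ⟨∑ i, frob (B₂ i) * κ, hM, fun t ht => (state_norm_le_iff hM _).2 ⟨fun i j => ?_, ?_, ?_⟩⟩
  · have e : (rhs p φ s ε t 0).1 i = B₂ i *ᵥ φ t (s.ρ t, s.ξ t) (s.xc t) i := by
      simp only [rhs, Prod.fst_zero, Prod.snd_zero, xiHat_zero, xc3Hat_zero, Pi.zero_apply,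
        Matrix.mulVec_zero, sub_self, add_zero, zero_add, smul_smul, inv_mul_cancel₀ hε, one_smul]
    refine (abs_apply_le_vnorm ((rhs p φ s ε t 0).1 i) j).trans ?_
    rw [e]
    refine ((vnorm_mulVec_le _ _).trans (mul_le_mul_of_nonneg_left
      (hφ.vnorm_le hΩsub hs ht i) (frob_nonneg _))).trans ?_
    exact Finset.single_le_sum (f := fun i => frob (B₂ i) * κ) (fun i _ => hB i) (Finset.mem_univ i)
  · intro k
    simpa [rhs] using hM
  · intro k
    simpa [rhs] using hM

/-- The error dynamics have a global solution if every solution of the truncated dynamics stays in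
a bounded set on which the truncation is inactive. -/
theorem exists_solution (p : Params n) {Ωsub : Set Pair} (hΩsub : closure Ωsub ⊆ Ωξ p)
    {φ : Disturbance} {κ : ℝ} (hφ : BoundedBy p φ κ) {s : Signals n} (hs : s.Admissible p Ωsub)
    {ε : ℝ} (hε : ε ≠ 0) {A : Set (State n)} {R : ℝ} (hR : 0 ≤ R) (hA : ∀ Δ ∈ A, ‖Δ‖ ≤ R)
    (hinv : ∀ T, ∀ x x' : ℝ → State n,
      (∀ t ∈ Set.Icc 0 T, HasDerivWithinAt x (x' t) (Set.Icc 0 T) t) →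
      (∀ t ∈ Set.Ico 0 T, x t ∈ A → x' t = rhs p φ s ε t (x t)) → x 0 ∈ A →
      ∀ t ∈ Set.Icc 0 T, x t ∈ A)
    {Δ₀ : State n} (hΔ₀ : Δ₀ ∈ A) :
    ∃ Δ : ℝ → State n, Δ 0 = Δ₀ ∧ IsSolution p φ s ε (Set.Ici 0) Δ := by
  obtain ⟨K, hK, hlip⟩ := exists_rhs_lipschitz p hΩsub φ hs ε hR
  obtain ⟨M, hM, hbd⟩ := exists_rhs_zero_bound p hΩsub hφ hs hε
  have hKR : 0 ≤ M + K * R := by positivity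
  obtain ⟨x, hx0, hx⟩ := exists_global_solution_of_lipschitz_of_bounded
    (w := fun t Δ => rhs p φ s ε t (clampState R Δ)) (K := ⟨K, hK⟩) (M := ⟨M + K * R, hKR⟩)
    (fun t ht => LipschitzWith.of_dist_le_mul fun Δ Γ => by
      rw [dist_eq_norm, dist_eq_norm]
      exact (hlip t ht _ _ (norm_clampState_le hR Δ) (norm_clampState_le hR Γ)).trans
        (mul_le_mul_of_nonneg_left (norm_clampState_sub_le R Δ Γ) hK))
    (fun Δ => continuousOn_rhs hΩsub hφ hs ε _)
    (fun t ht Δ => by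
      have h1 := hlip t ht (clampState R Δ) 0 (norm_clampState_le hR Δ) (by simpa using hR)
      rw [sub_zero] at h1
      have h2 := mul_le_mul_of_nonneg_left (norm_clampState_le hR Δ) hK
      have h3 := norm_le_norm_add_norm_sub' (rhs p φ s ε t (clampState R Δ)) (rhs p φ s ε t 0)
      have h4 := hbd t ht
      change _ ≤ M + K * R
      linarith) Δ₀
  refine ⟨x, hx0, fun t ht => ?_⟩
  -- On `A` the truncation is the identity, so the truncated solution meets the requirement of
  -- `hinv`, which constrains the derivative only there.
  have hmem : x t ∈ A := by
    refine hinv t x _ (fun u hu => (hx u hu.1).mono Set.Icc_subset_Ici_self) (fun u hu hux => ?_)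
      (by rwa [hx0]) t ⟨ht, le_rfl⟩
    rw [clampState_of_norm_le (hA _ hux)]
  have h := hx t ht
  rwa [clampState_of_norm_le (hA _ hmem)] at h

/-- This supplies the truncation radius. Its dependence on the weights and on `ε` is harmless, as it
enters only the existence of solutions. -/
theorem exists_norm_le_of_VΔ_le {P : ObsMatrices} {c d₂ d₃ ε : ℝ} (hc : 0 < c)
    (hP : ∀ η : Eta, c * etaNorm η ^ 2 ≤ obsForm P η) (hd₂ : 0 < d₂) (hd₃ : 0 < d₃) (hε : 0 < ε)
    (b : ℝ) : ∃ R, 0 ≤ R ∧ ∀ Δ : State n, VΔ P d₂ d₃ ε Δ ≤ b → ‖Δ‖ ≤ R := by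
  obtain ⟨m, hm⟩ : ∃ m, m = min (d₃ * (ε⁻¹ * c)) (min d₂ 1) := ⟨_, rfl⟩
  have hm0 : 0 < m := by rw [hm]; positivity
  have m1 : m ≤ d₃ * (ε⁻¹ * c) := hm ▸ min_le_left _ _
  have m2 : m ≤ d₂ := hm ▸ (min_le_right _ _).trans (min_le_left _ _)
  have m3 : m ≤ 1 := hm ▸ (min_le_right _ _).trans (min_le_right _ _)
  refine ⟨√(b / m), Real.sqrt_nonneg _, fun Δ hΔ => (norm_le_stateNorm Δ).trans ?_⟩
  refine Real.le_sqrt_of_sq_le ?_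
  rw [le_div_iff₀ hm0, stateNorm_sq]
  rw [VΔ_eq, Vω] at hΔ
  have h1 : d₃ * (ε⁻¹ * (c * etaNorm Δ.1 ^ 2)) ≤ d₃ * (ε⁻¹ * obsForm P Δ.1) := by
    have := hP Δ.1
    gcongr
  have h2 := mul_le_mul_of_nonneg_right m1 (sq_nonneg (etaNorm Δ.1))
  have h3 := mul_le_mul_of_nonneg_right m2 (dotProduct_self_nonneg' Δ.2.1)
  have h4 := mul_le_mul_of_nonneg_right m3 (dotProduct_self_nonneg' Δ.2.2)
  linarith

end EHGO

end

/-! ### Choice of the constants and conclusion. -/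

theorem theorem2 {n : ℕ} (hn : 0 < n) (p : EHGO.Params n)
    (P : EHGO.ObsMatrices)
    (hP : ∀ i, P i * EHGO.F p i + (EHGO.F p i)ᵀ * P i = -1)
    (Ωsub : Set EHGO.Pair) (hΩsub : closure Ωsub ⊆ EHGO.Ωξ p) :
    ∃ C > 0, ∃ μ > 0, ∃ d₂max > 0, ∀ d₂, 0 < d₂ → d₂ < d₂max →
    ∃ d₃max > 0, ∀ cω > 0, ∀ κ > 0,
    ∃ εmax > 0, ∀ ε, 0 < ε → ε < εmax → ∀ d₃, 0 < d₃ → d₃ < d₃max * ε ^ 2 →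
      0 < EHGO.cΔ p Ωsub P d₂ d₃ cω ε ∧
      ∀ φ : EHGO.Disturbance, EHGO.BoundedBy p φ κ →
      ∀ s : EHGO.Signals n, s.Admissible p Ωsub →
        (∀ Δ₀ ∈ EHGO.ΩΔ p Ωsub P d₂ d₃ cω ε,
          ∃ Δ : ℝ → EHGO.State n, Δ 0 = Δ₀ ∧ EHGO.IsSolution p φ s ε (Set.Ici 0) Δ) ∧
        (∀ T > 0, ∀ Δ : ℝ → EHGO.State n, EHGO.IsSolution p φ s ε (Set.Icc 0 T) Δ →
          Δ 0 ∈ EHGO.ΩΔ p Ωsub P d₂ d₃ cω ε →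
          ∀ t ∈ Set.Icc 0 T,
            Δ t ∈ EHGO.ΩΔ p Ωsub P d₂ d₃ cω ε ∧
            EHGO.stateNorm (Δ t) ≤
              C * Real.exp (-μ * t) * EHGO.stateNorm (Δ 0) + C * (ε * κ)) := by
  have hτ := p.hτm
  have hω := p.hωmax
  obtain ⟨_, _, R, hR, hRξ⟩ := EHGO.exists_bound_Ωξ p
  obtain ⟨r, hr, hmargin⟩ := EHGO.exists_margin p Ωsub hΩsub
  obtain ⟨c, hc, hPc'⟩ := EHGO.exists_coercive p P hP
  have hPc : ∀ η : EHGO.Eta, c * EHGO.etaNorm η ^ 2 ≤ EHGO.obsForm P η := fun η => by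
    rw [EHGO.etaNorm_sq]; exact hPc' η
  obtain ⟨Λ, hΛ, hPΛ⟩ := EHGO.exists_obsForm_le P
  -- The radius `3R` is the bound on the rate estimates over `Ω_Δ`.
  obtain ⟨C₁, hC₁, C₂, hC₂, ε₀, hε₀, hdis⟩ :=
    EHGO.exists_observer_dissipation p P hP Ωsub hΩsub (3 * R) (by positivity)
  obtain ⟨C, hC, hbound⟩ := EHGO.exists_exponential_bound p P hC₁ hC₂ hΛ hc hPc hPΛ
  refine ⟨C, hC, (2 * p.τm)⁻¹, by positivity, 1 / (2 * p.ωmax ^ 2), by positivity,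
    fun d₂ hd₂ hd₂max => ⟨d₂ / (C₁ * p.τm), by positivity, fun cω hcω κ hκ => ?_⟩⟩
  rw [lt_div_iff₀ (by positivity)] at hd₂max
  obtain ⟨q, hq⟩ : ∃ q, q = p.τm * (C₂ * (d₂ / (C₁ * p.τm)) * κ ^ 2) := ⟨_, rfl⟩
  have hq0 : 0 < q := by rw [hq]; positivity
  obtain ⟨z, hz⟩ : ∃ z, z = p.τm * (C₂ * κ ^ 2) := ⟨_, rfl⟩
  have hz0 : 0 < z := by rw [hz]; positivity
  -- The bounds serve, in order, the observer dissipation, the separation of time scales, `ε² ≤ ε`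
  -- and `ε³ ≤ ε`, and the position of the threshold `τm C₂ d₃ κ²` below each of the two levels in
  -- `le_cΔ`. In the last comparison `d₃` cancels.
  refine ⟨min (min ε₀ (p.τm / (4 * Λ))) (min 1 (min (cω / q) (r ^ 2 * c / z))), by positivity,
    fun ε hε hεmax d₃ hd₃ hd₃max => ?_⟩
  simp only [lt_min_iff] at hεmax
  obtain ⟨⟨hεε₀, hεΛ⟩, hε1, hεω, hεr⟩ := hεmax
  rw [lt_div_iff₀ (by positivity)] at hεΛ hεω hεr
  have hεΛ4 : 4 * Λ * ε ≤ p.τm := by linarith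
  have hd₃le : d₃ * (C₁ * p.τm) ≤ d₂ * ε ^ 2 := by
    rw [div_mul_eq_mul_div, lt_div_iff₀ (by positivity)] at hd₃max
    exact hd₃max.le
  have hlow := EHGO.le_cΔ (Ωsub := Ωsub) hn hc hPc hr hmargin hd₂ hd₃ hcω hε hε1.le
  have hε2 : ε ^ 2 ≤ ε := by nlinarith
  have hε3 : ε ^ 3 ≤ ε := by nlinarith
  have hcΔ : p.τm * (C₂ * d₃ * κ ^ 2) < EHGO.cΔ p Ωsub P d₂ d₃ cω ε := by
    refine lt_of_lt_of_le (lt_min ?_ ?_) hlow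
    · have h1 : p.τm * (C₂ * d₃ * κ ^ 2) ≤ q * ε ^ 2 := by
        have : p.τm * C₂ * κ ^ 2 * d₃ ≤ p.τm * C₂ * κ ^ 2 * (d₂ / (C₁ * p.τm) * ε ^ 2) :=
          mul_le_mul_of_nonneg_left hd₃max.le (by positivity)
        rw [hq]
        linarith
      have h2 := mul_le_mul_of_nonneg_left hε2 hq0.le
      linarith
    · rw [lt_div_iff₀ (by positivity)]
      have h1 := mul_le_mul_of_nonneg_left hε3 hz0.le
      have h2 : z * ε ^ 3 < r ^ 2 * c := by linarith
      have h3 := mul_lt_mul_of_pos_right h2 hd₃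
      rw [hz] at h3
      linarith
  have hcΔ0 : 0 < EHGO.cΔ p Ωsub P d₂ d₃ cω ε := lt_of_le_of_lt (by positivity) hcΔ
  refine ⟨hcΔ0, fun φ hφ s hs => ?_⟩
  have hdisΔ : ∀ t, 0 ≤ t → ∀ Δ ∈ EHGO.ΩΔ p Ωsub P d₂ d₃ cω ε,
      ε * EHGO.obsFormDeriv P Δ.1 (EHGO.rhs p φ s ε t Δ).1 ≤
        -(1 / 2) * EHGO.etaNorm Δ.1 ^ 2 + C₁ * (Δ.2.1 ⬝ᵥ Δ.2.1) + C₂ * (ε ^ 2 * κ ^ 2) := by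
    intro t ht Δ hΔ
    have hRall : ∀ ξ ∈ EHGO.Ωξ p, EHGO.vnorm ξ.2 ≤ R := fun ξ hξ => (hRξ ξ hξ).2
    have h1 := hRall _ (hΩsub (subset_closure (hs.mem_ξ t ht)))
    exact hdis ε hε hεε₀.le κ φ hφ s hs t ht Δ (by linarith)
      (EHGO.vnorm_xiHat_le_of_mem_ΩΔ hΩsub hRall hcΔ0 hΔ (hs.mem_ξ t ht))
  -- The derivative is tied to the dynamics only while the curve is in `Ω_Δ`, so that the statement
  -- serves both the true and the truncated system.
  have hinv : ∀ T, ∀ x x' : ℝ → EHGO.State n,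
      (∀ t ∈ Set.Icc 0 T, HasDerivWithinAt x (x' t) (Set.Icc 0 T) t) →
      (∀ t ∈ Set.Ico 0 T, x t ∈ EHGO.ΩΔ p Ωsub P d₂ d₃ cω ε →
        x' t = EHGO.rhs p φ s ε t (x t)) →
      x 0 ∈ EHGO.ΩΔ p Ωsub P d₂ d₃ cω ε →
      ∀ t ∈ Set.Icc 0 T, x t ∈ EHGO.ΩΔ p Ωsub P d₂ d₃ cω ε := by
    intro T x x' hx hx' h0
    refine EHGO.VΔ_le_of_deriv_neg hx (fun t ht heq => ?_) h0
    have hmem : x t ∈ EHGO.ΩΔ p Ωsub P d₂ d₃ cω ε := heq.le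
    rw [hx' t ht hmem]
    exact EHGO.VΔ_deriv_neg hε hd₃ hτ (hdisΔ t ht.1 _ hmem)
      (EHGO.VωDeriv_rhs_le p hs φ ε ht.1 hd₂.le (by linarith) (x t)) (hPΛ _)
      (by nlinarith [mul_pos hΛ hε]) hd₃le (by rw [heq]; exact hcΔ)
  constructor
  · intro Δ₀ hΔ₀
    obtain ⟨R', hR', hnorm⟩ := EHGO.exists_norm_le_of_VΔ_le (n := n) hc hPc hd₂ hd₃ hε
      (EHGO.cΔ p Ωsub P d₂ d₃ cω ε)
    exact EHGO.exists_solution p hΩsub hφ hs hε.ne' hR' hnorm hinv hΔ₀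
  · intro T _ Δ hΔ h0 t ht
    have hmem := hinv T Δ _ hΔ (fun _ _ _ => rfl) h0
    exact ⟨hmem t ht, hbound ε hε hεΛ4 κ hκ Ωsub φ s hs T Δ hΔ
      (fun u hu => hdisΔ u hu.1 _ (hmem u hu)) t ht⟩
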